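/- The $b$-biased orientation game on $K_n$ is played by Maker and Breaker, who alternately orient previously undirected edges of $K_n$, with Maker moving first. In each of his turns Maker orients exactly one edge; in each of his turns Breaker orients at least one and at most $b$ edges ($b\ge 1$ an integer; if fewer than $b$ edges are left he orients at most those). The game ends when all edges are oriented, i.e. with a tournament on $n$ vertices. Maker wins the Hamiltonicity game if this tournament contains a directed Hamilton cycle (no matter who oriented its edges), and otherwise Breaker wins. 1. For every $\varepsilon>0$ there is $n_0$ such that for all $n\ge n_0$ and all $b\ge (1+\varepsilon)\,n/\ln n$, Breaker has a strategy which guarantees that in the $b$-biased orientation game on $K_n$ the final tournament has a vertex of in-degree $0$, and in particular has no Hamilton cycle, so that Breaker wins the Hamiltonicity game. 2. For every $\varepsilon>0$ there is $n_0$ such that for all $n\ge n_0$ and all $1\le b\le (1-\varepsilon)\,n/\ln n$, Maker has a strategy which guarantees that in the $b$-biased orientation game on $K_n$ the final tournament contains a Hamilton cycle. -/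

import Mathlib

open Filter

namespace OrientationGame

/-- A directed graph on the vertex set `V`, given by its set of arcs; `(u, v)` is the arc from
`u` to `v`. A position of the game is the set of edges oriented so far, with their directions. -/
abbrev Arcs (V : Type*) := Finset (V × V)

/-- No loops and no pair of opposite arcs. -/
def IsOriented {V : Type*} (D : Arcs V) : Prop :=
  ∀ u v : V, (u, v) ∈ D → (v, u) ∉ D

/-- An orientation of the complete graph on `V`. -/
def IsTournament {V : Type*} (D : Arcs V) : Prop :=
  IsOriented D ∧ ∀ u v : V, u ≠ v → (u, v) ∈ D ∨ (v, u) ∈ D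

/-- The number of arcs entering `v`. -/
def inDegree {V : Type*} [Fintype V] [DecidableEq V] (D : Arcs V) (v : V) : ℕ :=
  (Finset.univ.filter fun u : V => (u, v) ∈ D).card

/-- There is a directed cycle through all the vertices: the successor map along it is a cyclic
permutation of `V` moving every vertex. -/
def HasHamiltonCycle {V : Type*} [Fintype V] [DecidableEq V] (D : Arcs V) : Prop :=
  ∃ s : Equiv.Perm V, s.IsCycle ∧ s.support = Finset.univ ∧ ∀ v : V, (v, s v) ∈ D

/-- In one turn with bias `q` a player orients at least one and at most `q` previously undirected
edges, which turns the position `D` into `D'`. -/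
def LegalMove {V : Type*} [DecidableEq V] (q : ℕ) (D D' : Arcs V) : Prop :=
  D ⊆ D' ∧ IsOriented D' ∧ 1 ≤ (D' \ D).card ∧ (D' \ D).card ≤ q

/-- A strategy of a player: from the list of all earlier positions (latest first) and the current
position it determines the position after the player's turn. -/
abbrev Strategy (V : Type*) := List (Arcs V) → Arcs V → Arcs V

/-- The strategy makes a legal move with bias `q` as long as some edge is undirected. -/
def Strategy.Legal {V : Type*} [DecidableEq V] (q : ℕ) (S : Strategy V) : Prop :=
  ∀ (h : List (Arcs V)) (D : Arcs V), IsOriented D → ¬ IsTournament D → LegalMove q D (S h D)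

open Classical in
/-- The earlier positions and the current position after `k` turns, when Maker plays `S` and
Breaker plays `R`. No edge is oriented at the start, the players alternate, Maker has the first
turn, and the game stops when all edges are oriented. -/
noncomputable def play {V : Type*} (S R : Strategy V) : ℕ → List (Arcs V) × Arcs V
  | 0 => ([], ∅)
  | k + 1 =>
    let h := (play S R k).1
    let D := (play S R k).2
    if IsTournament D then (h, D)
    else (D :: h, if Even k then S h D else R h D)

/-- When Maker plays `S` and Breaker plays `R`, the game ends with a tournament that has the
property `P`. -/
def EndsWith {V : Type*} (S R : Strategy V) (P : Arcs V → Prop) : Prop :=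
  ∃ k : ℕ, IsTournament (play S R k).2 ∧ P (play S R k).2

/-- In the `(p : q)` orientation game on the complete graph on `V`, Maker has a strategy
guaranteeing that the final tournament has the property `P`. -/
def MakerCanForce (V : Type*) [DecidableEq V] (p q : ℕ) (P : Arcs V → Prop) : Prop :=
  ∃ S : Strategy V, S.Legal p ∧ ∀ R : Strategy V, R.Legal q → EndsWith S R P

/-- In the `(p : q)` orientation game on the complete graph on `V`, Breaker has a strategy
guaranteeing that the final tournament has the property `P`. -/
def BreakerCanForce (V : Type*) [DecidableEq V] (p q : ℕ) (P : Arcs V → Prop) : Prop :=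
  ∃ R : Strategy V, R.Legal q ∧ ∀ S : Strategy V, S.Legal p → EndsWith S R P

end OrientationGame

/-! Both parts are won by position-based strategies: `Wins` describes positions from which a player
can force the goal, and induction over it replaces histories by positions.

Breaker plays a box game. He fixes a set `A` of about `n / ln n` candidate sources and directs arcs
from them to vertices outside `A`, spread evenly over the candidates still of in-degree `0`. Each
arc of Maker spoils at most one candidate. While `j` survive, each gains about `b / j` arcs per
turn, so the last survivor has gained about `b ln (n / ln n)`, which exceeds `n` up to lower-order
terms; Breaker then completes it in one turn (`wins_of_alive`, `le_boxBound`).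

Maker aims at a strongly connected tournament, which has a Hamilton cycle by Camion's theorem
(`IsTournament.hasHamiltonCycle`). He first gives every vertex two in-neighbours and two
out-neighbours, each time treating an unfinished vertex of maximal danger. Comparing averages of
danger over vertex sets, and counting edges inside small sets only once, bounds the degree of an
unfinished vertex by `b ln n` plus small terms (`Balanced.step`, `incidentBound_one_le`), so about
`ε n / 4` choices always remain. Were the neighbours chosen at random, a union bound would show that
all sets of size at most `t = κ n` are entered and left; the two neighbours in each direction give
the exponent `2k` that beats `n.choose k`. The potential function derandomizes this choice
(`exists_potential_update_le`, `potential_none_lt_one`).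

These `4n` turns orient only a small proportion of the edges. Every remaining uncrossed cut
therefore has quadratically many free arcs, and some arc crosses a constant proportion of all such
cuts. As there are at most `2 ^ n` cuts, `C n` further turns cross them all
(`wins_of_smallCutsCrossed`). -/

namespace OrientationGame

/-! ### Winning positions and strategies -/

section Positions

variable {V : Type*}

theorem isOriented_empty : IsOriented (∅ : Arcs V) := by
  intro u v h
  simp at h

theorem IsOriented.irrefl {D : Arcs V} (h : IsOriented D) (u : V) : (u, u) ∉ D :=
  fun hu => h u u hu hu

theorem IsOriented.ne {D : Arcs V} (h : IsOriented D) {u v : V} (huv : (u, v) ∈ D) : u ≠ v := by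
  rintro rfl
  exact h.irrefl u huv

theorem play_succ_of_even (S R : Strategy V) {k : ℕ} (h : ¬ IsTournament (play S R k).2)
    (hk : Even k) : (play S R (k + 1)).2 = S (play S R k).1 (play S R k).2 := by
  simp [play, h, hk]

theorem play_succ_of_odd (S R : Strategy V) {k : ℕ} (h : ¬ IsTournament (play S R k).2)
    (hk : ¬ Even k) : (play S R (k + 1)).2 = R (play S R k).1 (play S R k).2 := by
  simp [play, h, hk]

variable [DecidableEq V]

theorem IsOriented.insert {D : Arcs V} (h : IsOriented D) {u v : V} (huv : u ≠ v)
    (hvu : (v, u) ∉ D) : IsOriented (insert (u, v) D) := by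
  intro a b hab hba
  simp only [Finset.mem_insert, Prod.mk.injEq] at hab hba
  rcases hab with ⟨rfl, rfl⟩ | hab
  · rcases hba with ⟨rfl, -⟩ | hba
    · exact huv rfl
    · exact hvu hba
  · rcases hba with ⟨rfl, rfl⟩ | hba
    · exact hvu hab
    · exact h a b hab hba

theorem legalMove_insert {D : Arcs V} (h : IsOriented D) {u v : V} (huv : u ≠ v)
    (h1 : (u, v) ∉ D) (h2 : (v, u) ∉ D) {q : ℕ} (hq : 1 ≤ q) :
    LegalMove q D (insert (u, v) D) := by
  refine ⟨Finset.subset_insert _ _, h.insert huv h2, ?_, ?_⟩ <;>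
    rw [Finset.insert_sdiff_of_notMem _ h1] <;> simp [hq]

theorem exists_legalMove {D : Arcs V} (h : IsOriented D) (hT : ¬ IsTournament D) {q : ℕ}
    (hq : 1 ≤ q) : ∃ D', LegalMove q D D' := by
  simp only [IsTournament, not_and, not_forall, not_or] at hT
  obtain ⟨u, v, huv, h1, h2⟩ := hT h
  exact ⟨_, legalMove_insert h huv h1 h2 hq⟩

theorem LegalMove.not_isTournament {q : ℕ} {D D' : Arcs V} (h : LegalMove q D D') :
    ¬ IsTournament D := by
  rintro ⟨-, hT⟩
  obtain ⟨hsub, hO, h1, -⟩ := h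
  obtain ⟨⟨u, v⟩, hx⟩ := Finset.card_pos.1 h1
  rw [Finset.mem_sdiff] at hx
  rcases hT u v (hO.ne hx.1) with h | h
  · exact hx.2 h
  · exact hO u v hx.1 (hsub h)

theorem LegalMove.card_lt {q : ℕ} {D D' : Arcs V} (h : LegalMove q D D') : D.card < D'.card := by
  have := Finset.card_sdiff_add_card_eq_card h.1
  have := h.2.2.1
  omega

/-- The player about to move at `D` with bias `p` can force `P`, even if the opponent with bias
`q` may pass. -/
inductive Wins (p q : ℕ) (P : Arcs V → Prop) : Arcs V → Prop
  | final {D : Arcs V} : IsTournament D → P D → Wins p q P D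
  | move {D D' : Arcs V} : LegalMove p D D' →
      (∀ D'', D' ⊆ D'' → IsOriented D'' → (D'' \ D').card ≤ q → Wins p q P D'') → Wins p q P D

variable {p q : ℕ} {P : Arcs V → Prop}

theorem Wins.of_isTournament {D : Arcs V} (h : Wins p q P D) (hT : IsTournament D) : P D := by
  cases h with
  | final _ hP => exact hP
  | move hL _ => exact absurd hT hL.not_isTournament

theorem Wins.exists_move {D : Arcs V} (h : Wins p q P D) (hT : ¬ IsTournament D) :
    ∃ D', LegalMove p D D' ∧
      ∀ D'', D' ⊆ D'' → IsOriented D'' → (D'' \ D').card ≤ q → Wins p q P D'' := by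
  cases h with
  | final hT' _ => exact absurd hT' hT
  | move hL h => exact ⟨_, hL, h⟩

open Classical in
/-- Move to a position that stays winning whatever the reply, whenever there is one. -/
noncomputable def winningStrategy (p q : ℕ) (P : Arcs V → Prop) : Strategy V := fun _ D =>
  if h : ∃ D', LegalMove p D D' ∧
      ∀ D'', D' ⊆ D'' → IsOriented D'' → (D'' \ D').card ≤ q → Wins p q P D'' then h.choose
  else if h : ∃ D', LegalMove p D D' then h.choose else D

theorem winningStrategy_legal (hp : 1 ≤ p) : (winningStrategy p q P).Legal p := by
  intro h D hO hT
  unfold winningStrategy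
  split_ifs with h1 h2
  · exact h1.choose_spec.1
  · exact h2.choose_spec
  · exact absurd (exists_legalMove hO hT hp) h2

theorem Wins.winningStrategy {D : Arcs V} (h : Wins p q P D) (hT : ¬ IsTournament D)
    (l : List (Arcs V)) : LegalMove p D (winningStrategy p q P l D) ∧
      ∀ D'', winningStrategy p q P l D ⊆ D'' → IsOriented D'' →
        (D'' \ winningStrategy p q P l D).card ≤ q → Wins p q P D'' := by
  unfold OrientationGame.winningStrategy
  rw [dif_pos (h.exists_move hT)]
  exact (h.exists_move hT).choose_spec

variable [Fintype V]

/-- `N` bounds the number of arcs that can still be added. Every turn adds one at least, so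
induction on `N` exhausts the game; two consecutive turns correspond to one use of `Wins.move`. -/
theorem Wins.endsWith_maker {R : Strategy V} (hR : R.Legal q) (N k : ℕ) (hk : Even k)
    (hN : Fintype.card (V × V) ≤ N + (play (OrientationGame.winningStrategy p q P) R k).2.card)
    (hW : Wins p q P (play (OrientationGame.winningStrategy p q P) R k).2) :
    EndsWith (OrientationGame.winningStrategy p q P) R P := by
  induction N generalizing k with
  | zero =>
    refine ⟨k, ?_⟩
    by_cases hT : IsTournament (play (OrientationGame.winningStrategy p q P) R k).2
    · exact ⟨hT, hW.of_isTournament hT⟩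
    · have := (hW.winningStrategy hT []).1.card_lt
      have := Finset.card_le_univ (OrientationGame.winningStrategy p q P []
        (play (OrientationGame.winningStrategy p q P) R k).2)
      omega
  | succ N ih =>
    by_cases hT : IsTournament (play (OrientationGame.winningStrategy p q P) R k).2
    · exact ⟨k, hT, hW.of_isTournament hT⟩
    · obtain ⟨hL, hW'⟩ := hW.winningStrategy hT
        (play (OrientationGame.winningStrategy p q P) R k).1
      rw [← play_succ_of_even _ _ hT hk] at hL hW'
      by_cases hT' : IsTournament (play (OrientationGame.winningStrategy p q P) R (k + 1)).2
      · exact ⟨k + 1, hT', (hW' _ subset_rfl hT'.1 (by simp)).of_isTournament hT'⟩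
      · have hk' : ¬ Even (k + 1) := by simpa [Nat.even_add_one] using hk
        have hL' := hR (play (OrientationGame.winningStrategy p q P) R (k + 1)).1 _ hL.2.1 hT'
        rw [← play_succ_of_odd _ _ hT' hk'] at hL'
        refine ih (k + 1 + 1) (by simpa [Nat.even_add_one] using hk) ?_
          (hW' _ hL'.1 hL'.2.1 hL'.2.2.2)
        have := hL.card_lt
        have := hL'.card_lt
        omega

theorem Wins.endsWith_breaker {S : Strategy V} (hS : S.Legal q) (N k : ℕ) (hk : ¬ Even k)
    (hN : Fintype.card (V × V) ≤ N + (play S (OrientationGame.winningStrategy p q P) k).2.card)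
    (hW : Wins p q P (play S (OrientationGame.winningStrategy p q P) k).2) :
    EndsWith S (OrientationGame.winningStrategy p q P) P := by
  induction N generalizing k with
  | zero =>
    refine ⟨k, ?_⟩
    by_cases hT : IsTournament (play S (OrientationGame.winningStrategy p q P) k).2
    · exact ⟨hT, hW.of_isTournament hT⟩
    · have := (hW.winningStrategy hT []).1.card_lt
      have := Finset.card_le_univ (OrientationGame.winningStrategy p q P []
        (play S (OrientationGame.winningStrategy p q P) k).2)
      omega
  | succ N ih =>
    by_cases hT : IsTournament (play S (OrientationGame.winningStrategy p q P) k).2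
    · exact ⟨k, hT, hW.of_isTournament hT⟩
    · obtain ⟨hL, hW'⟩ := hW.winningStrategy hT
        (play S (OrientationGame.winningStrategy p q P) k).1
      rw [← play_succ_of_odd _ _ hT hk] at hL hW'
      by_cases hT' : IsTournament (play S (OrientationGame.winningStrategy p q P) (k + 1)).2
      · exact ⟨k + 1, hT', (hW' _ subset_rfl hT'.1 (by simp)).of_isTournament hT'⟩
      · have hk' : Even (k + 1) := by simpa [Nat.even_add_one] using hk
        have hL' := hS (play S (OrientationGame.winningStrategy p q P) (k + 1)).1 _ hL.2.1 hT'
        rw [← play_succ_of_even _ _ hT' hk'] at hL'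
        refine ih (k + 1 + 1) (by simpa [Nat.even_add_one] using hk) ?_
          (hW' _ hL'.1 hL'.2.1 hL'.2.2.2)
        have := hL.card_lt
        have := hL'.card_lt
        omega

theorem makerCanForce_of_wins (hp : 1 ≤ p) (h : Wins p q P ∅) : MakerCanForce V p q P :=
  ⟨winningStrategy p q P, winningStrategy_legal hp, fun _ hR =>
    Wins.endsWith_maker hR _ 0 (by simp) (Nat.le_add_right _ _) h⟩

/-- Maker's opening turn is absorbed into the hypothesis, which covers every position that it can
produce. -/
theorem breakerCanForce_of_wins (hq : 1 ≤ q)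
    (h : ∀ D : Arcs V, IsOriented D → D.card ≤ p → Wins q p P D) : BreakerCanForce V p q P := by
  refine ⟨winningStrategy q p P, winningStrategy_legal hq, fun S hS => ?_⟩
  by_cases hT : IsTournament (∅ : Arcs V)
  · exact ⟨0, hT, (h ∅ isOriented_empty (by simp)).of_isTournament hT⟩
  · have hT0 : ¬ IsTournament (play S (winningStrategy q p P) 0).2 := hT
    have hL := hS (play S (winningStrategy q p P) 0).1 (play S (winningStrategy q p P) 0).2
      isOriented_empty hT0
    rw [← play_succ_of_even _ _ hT0 (by simp)] at hL
    refine Wins.endsWith_breaker hS _ 1 (by simp) (Nat.le_add_right _ _) (h _ hL.2.1 ?_)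
    have := hL.2.2.2
    simpa [play] using this

/-- Once a monotone property that implies `P` for tournaments holds, the rest of the game does
not matter. -/
theorem wins_of_monotone (hp : 1 ≤ p) {Q : Arcs V → Prop}
    (hQ : ∀ D D' : Arcs V, D ⊆ D' → Q D → Q D') (hQP : ∀ D, IsTournament D → Q D → P D)
    {D : Arcs V} (hO : IsOriented D) (hD : Q D) : Wins p q P D := by
  obtain ⟨N, hN⟩ : ∃ N, Fintype.card (V × V) ≤ N + D.card := ⟨_, Nat.le_add_right _ _⟩
  induction N generalizing D with
  | zero =>
    by_cases hT : IsTournament D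
    · exact .final hT (hQP D hT hD)
    · obtain ⟨D', hL⟩ := exists_legalMove hO hT hp
      have := hL.card_lt
      have := Finset.card_le_univ D'
      omega
  | succ N ih =>
    by_cases hT : IsTournament D
    · exact .final hT (hQP D hT hD)
    · obtain ⟨D', hL⟩ := exists_legalMove hO hT hp
      refine .move hL fun D'' hsub hO'' _ => ih hO'' (hQ _ _ (hL.1.trans hsub) hD) ?_
      have := hL.card_lt
      have := Finset.card_le_card hsub
      omega

end Positions

/-! ### Strongly connected tournaments: Camion's theorem -/

section Camion

variable {V : Type*} [DecidableEq V]

/-- Every nonempty proper set of vertices is left by an arc. -/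
def CutsCrossed [Fintype V] (D : Arcs V) : Prop :=
  ∀ S : Finset V, S.Nonempty → S ≠ Finset.univ → ∃ u ∈ S, ∃ v ∉ S, (u, v) ∈ D

/-- The product inserts the fixed point `v` into the cycle directly after `c`: now `c ↦ v ↦ s c`. -/
theorem isCycle_mul_swap [Finite V] {s : Equiv.Perm V} (hs : s.IsCycle) {c v : V} (hc : s c ≠ c)
    (hv : s v = v) : (s * Equiv.swap c v).IsCycle := by
  have hcv : c ≠ v := by rintro rfl; exact hc hv
  have h1 : (s * Equiv.swap c v) c = v := by simp [hv]
  have h2 : (s * Equiv.swap c v) v = s c := by simp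
  have h3 : ∀ y, y ≠ c → y ≠ v → (s * Equiv.swap c v) y = s y := by
    intro y hyc hyv
    simp [Equiv.swap_apply_of_ne_of_ne hyc hyv]
  have hc1 : (s * Equiv.swap c v).SameCycle c v := by
    have := Equiv.Perm.sameCycle_apply_right.2 (Equiv.Perm.SameCycle.refl (s * Equiv.swap c v) c)
    rwa [h1] at this
  have hstep : ∀ y, (s * Equiv.swap c v).SameCycle c y →
      (s * Equiv.swap c v).SameCycle c (s y) := by
    intro y hy
    by_cases hyc : y = c
    · rw [hyc, ← h2]
      exact Equiv.Perm.sameCycle_apply_right.2 hc1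
    · by_cases hyv : y = v
      · rw [hyv, hv]; exact hc1
      · rw [← h3 y hyc hyv]
        exact Equiv.Perm.sameCycle_apply_right.2 hy
  have hpow : ∀ n : ℕ, (s * Equiv.swap c v).SameCycle c ((s ^ n) c) := by
    intro n
    induction n with
    | zero => exact Equiv.Perm.SameCycle.refl _ _
    | succ n ih => rw [pow_succ', Equiv.Perm.mul_apply]; exact hstep _ ih
  refine ⟨c, by rw [h1]; exact hcv.symm, fun y hy => ?_⟩
  by_cases hyv : y = v
  · rw [hyv]; exact hc1
  · by_cases hyc : y = c
    · rw [hyc]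
    · rw [h3 y hyc hyv] at hy
      obtain ⟨n, rfl⟩ := hs.exists_pow_eq hc hy
      exact hpow n

variable [Fintype V]

/-- A vertex with arcs from and to a cycle can be inserted into the cycle. -/
theorem exists_larger_cycle_of_insert {D : Arcs V} {s : Equiv.Perm V} (hs : s.IsCycle)
    (hD : ∀ x ∈ s.support, (x, s x) ∈ D) {c a b : V} (hc : c ∈ s.support) (ha : a ∉ s.support)
    (hb : b ∉ s.support) (hca : (c, a) ∈ D) (hab : a = b ∨ (a, b) ∈ D)
    (hbc : (b, s c) ∈ D) :
    ∃ s' : Equiv.Perm V, s'.IsCycle ∧ (∀ x ∈ s'.support, (x, s' x) ∈ D) ∧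
      s.support.card < s'.support.card := by
  have hc' : s c ≠ c := Equiv.Perm.mem_support.1 hc
  have ha' : s a = a := by simpa using ha
  have hb' : s b = b := by simpa using hb
  have hcb : c ≠ b := by rintro rfl; exact hb hc
  have hcyc := isCycle_mul_swap hs hc' hb'
  have hsup : s.support ⊂ (s * Equiv.swap c b).support := by
    refine (Finset.ssubset_iff_of_subset fun x hx => ?_).2 ⟨b, ?_, hb⟩
    · by_cases hxc : x = c
      · subst hxc
        simp [hb', hcb.symm]
      · have hxb : x ≠ b := by rintro rfl; exact hb hx
        simpa [Equiv.swap_apply_of_ne_of_ne hxc hxb] using hx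
    · have : s c ≠ b := by
        intro h; apply hcb; apply s.injective; rw [h, hb']
      simpa using this
  by_cases hab' : a = b
  · subst hab'
    refine ⟨_, hcyc, fun x hx => ?_, Finset.card_lt_card hsup⟩
    by_cases hxc : x = c
    · subst hxc; simpa [ha'] using hca
    · by_cases hxa : x = a
      · subst hxa; simpa using hbc
      · rw [Equiv.Perm.mem_support, Equiv.Perm.mul_apply,
          Equiv.swap_apply_of_ne_of_ne hxc hxa] at hx
        simpa [Equiv.swap_apply_of_ne_of_ne hxc hxa] using hD x (by simpa using hx)
  -- The path is inserted one vertex at a time: `b` after `c`, then `a` between `c` and `b`.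
  · replace hab := hab.resolve_left hab'
    have hca' : c ≠ a := by rintro rfl; exact ha hc
    have h1 : (s * Equiv.swap c b) c = b := by simp [hb']
    have h2 : (s * Equiv.swap c b) b = s c := by simp
    have h3 : (s * Equiv.swap c b) a = a := by
      simp [Equiv.swap_apply_of_ne_of_ne hca'.symm hab', ha']
    have h4 : ∀ x, x ≠ c → x ≠ b → (s * Equiv.swap c b) x = s x := by
      intro x hxc hxb
      simp [Equiv.swap_apply_of_ne_of_ne hxc hxb]
    have hcyc' := isCycle_mul_swap hcyc (by rw [h1]; exact hcb.symm : _ ≠ c) h3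
    set t := s * Equiv.swap c b with ht
    have k1 : (t * Equiv.swap c a) c = a := by simp [h3]
    have k2 : (t * Equiv.swap c a) a = b := by simp [h1]
    have k4 : ∀ x, x ≠ c → x ≠ a → (t * Equiv.swap c a) x = t x := by
      intro x hxc hxa
      simp [Equiv.swap_apply_of_ne_of_ne hxc hxa]
    refine ⟨_, hcyc', fun x hx => ?_, (Finset.card_lt_card hsup).trans_le
      (Finset.card_le_card fun x hx => ?_)⟩
    · by_cases hxc : x = c
      · rw [hxc, k1]; exact hca
      · by_cases hxa : x = a
        · rw [hxa, k2]; exact hab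
        · rw [Equiv.Perm.mem_support] at hx
          rw [k4 x hxc hxa] at hx ⊢
          by_cases hxb : x = b
          · rw [hxb, h2]; exact hbc
          · rw [h4 x hxc hxb] at hx ⊢
            exact hD x (by simpa using hx)
    · rw [Equiv.Perm.mem_support] at hx ⊢
      by_cases hxc : x = c
      · rw [hxc, k1]; exact hca'.symm
      · have hxa : x ≠ a := by rintro rfl; exact hx h3
        rwa [k4 x hxc hxa]

/-- There is a triangle through any `v`: an arc `(a, b)` leaves the out-neighbourhood of `v`, and `b
≠ v` because `v` sends an arc to `a`, so completeness gives `(b, v)`. -/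
theorem IsTournament.exists_cycle {D : Arcs V} (hT : IsTournament D) (hD : CutsCrossed D)
    (hV : 1 < Fintype.card V) :
    ∃ s : Equiv.Perm V, s.IsCycle ∧ ∀ x ∈ s.support, (x, s x) ∈ D := by
  obtain ⟨v⟩ : Nonempty V := Fintype.card_pos_iff.1 (by omega)
  obtain ⟨w, hw⟩ : ∃ w, (v, w) ∈ D := by
    obtain ⟨u, hu, w, -, h⟩ := hD {v} (by simp) (by
      intro h
      have := congrArg Finset.card h
      simp [Finset.card_univ] at this
      omega)
    rw [Finset.mem_singleton] at hu
    exact ⟨w, hu ▸ h⟩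
  obtain ⟨a, ha, b, hb, hab⟩ := hD (Finset.univ.filter fun x => (v, x) ∈ D) ⟨w, by simp [hw]⟩ (by
    intro h
    have := h ▸ Finset.mem_univ v
    simp [hT.1.irrefl] at this)
  simp only [Finset.mem_filter, Finset.mem_univ, true_and] at ha hb
  have hbv : b ≠ v := by rintro rfl; exact hT.1 _ _ ha hab
  have hbv' : (b, v) ∈ D := (hT.2 b v hbv).resolve_right hb
  have hav : a ≠ v := (hT.1.ne ha).symm
  have hab' : a ≠ b := hT.1.ne hab
  refine ⟨Equiv.swap a b * Equiv.swap b v, isCycle_mul_swap (Equiv.Perm.isCycle_swap hab')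
    (by simpa using hab') (Equiv.swap_apply_of_ne_of_ne hav.symm hbv.symm), fun x hx => ?_⟩
  by_cases hxb : x = b
  · subst hxb
    simpa [Equiv.swap_apply_of_ne_of_ne hav.symm hbv.symm] using hbv'
  · by_cases hxv : x = v
    · subst hxv; simpa using ha
    · by_cases hxa : x = a
      · subst hxa; simpa [Equiv.swap_apply_of_ne_of_ne hab' hav] using hab
      · simp [Equiv.swap_apply_of_ne_of_ne hxb hxv, Equiv.swap_apply_of_ne_of_ne hxa hxb] at hx

/-- If some arc leads from the cycle to `v` and some arc from `v` to the cycle, then this happens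
at consecutive vertices. -/
theorem IsTournament.exists_consecutive {D : Arcs V} (hT : IsTournament D) {s : Equiv.Perm V}
    (hs : s.IsCycle) {v c d : V} (hv : v ∉ s.support) (hc : c ∈ s.support) (hd : d ∈ s.support)
    (hcv : (c, v) ∈ D) (hvd : (v, d) ∈ D) : ∃ e ∈ s.support, (e, v) ∈ D ∧ (v, s e) ∈ D := by
  by_contra! hcon
  have hall : ∀ n : ℕ, (s ^ n) c ∈ s.support ∧ ((s ^ n) c, v) ∈ D := by
    intro n
    induction n with
    | zero => exact ⟨hc, hcv⟩
    | succ n ih =>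
      rw [pow_succ', Equiv.Perm.mul_apply]
      have hmem : s ((s ^ n) c) ∈ s.support := Equiv.Perm.apply_mem_support.2 ih.1
      refine ⟨hmem, (hT.2 _ _ ?_).resolve_right (hcon _ ih.1 ih.2)⟩
      intro h
      exact hv (h ▸ hmem)
  obtain ⟨n, rfl⟩ := hs.exists_pow_eq (Equiv.Perm.mem_support.1 hc) (Equiv.Perm.mem_support.1 hd)
  exact hT.1 _ _ hvd (hall n).2

/-- Camion's theorem: a strongly connected tournament has a Hamilton cycle. -/
theorem IsTournament.hasHamiltonCycle {D : Arcs V} (hT : IsTournament D) (hD : CutsCrossed D)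
    (hV : 1 < Fintype.card V) : HasHamiltonCycle D := by
  classical
  obtain ⟨s₀, hs₀⟩ := hT.exists_cycle hD hV
  obtain ⟨s, hs, hmax⟩ := Finset.exists_max_image
    (Finset.univ.filter fun s : Equiv.Perm V => s.IsCycle ∧ ∀ x ∈ s.support, (x, s x) ∈ D)
    (fun s => s.support.card) ⟨s₀, by simpa using hs₀⟩
  rw [Finset.mem_filter] at hs
  obtain ⟨-, hcyc, harc⟩ := hs
  have hno : ∀ {c a b : V}, c ∈ s.support → a ∉ s.support → b ∉ s.support → (c, a) ∈ D →
      (a = b ∨ (a, b) ∈ D) → (b, s c) ∉ D := by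
    intro c a b hc ha hb hca hab hbc
    obtain ⟨s', h1, h2, h3⟩ := exists_larger_cycle_of_insert hcyc harc hc ha hb hca hab hbc
    have := hmax s' (by simp only [Finset.mem_filter, Finset.mem_univ, true_and]; exact ⟨h1, h2⟩)
    omega
  -- By maximality, a vertex off the cycle receives arcs from the whole cycle or from none of it.
  have hdich : ∀ {v c d : V}, v ∉ s.support → c ∈ s.support → d ∈ s.support → (c, v) ∈ D →
      (d, v) ∈ D := by
    intro v c d hv hc hd hcv
    by_contra hdv
    have hvd : (v, d) ∈ D :=
      (hT.2 v d (by rintro rfl; exact hv hd)).resolve_right hdv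
    obtain ⟨e, he, h1, h2⟩ := hT.exists_consecutive hcyc hv hc hd hcv hvd
    exact hno he hv hv h1 (Or.inl rfl) h2
  have hne : s.support.Nonempty := by
    obtain ⟨x, hx, -⟩ := hcyc
    exact ⟨x, by simpa using hx⟩
  obtain ⟨c₀, hc₀⟩ := hne
  suffices hsup : s.support = Finset.univ from
    ⟨s, hcyc, hsup, fun v => harc v (by rw [hsup]; simp)⟩
  by_contra hsup
  obtain ⟨c, hc, a, ha, hca⟩ := hD s.support ⟨c₀, hc₀⟩ hsup
  -- The outside vertices dominated by the cycle are left by an arc `(a', b)`. Then `b` lies off the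
  -- cycle and dominates it, so `c₀ → a' → b → s c₀` enlarges the cycle.
  obtain ⟨a', ha', b, hb, hab⟩ := hD
    (Finset.univ.filter fun x => x ∉ s.support ∧ (c₀, x) ∈ D)
    ⟨a, by simp only [Finset.mem_filter, Finset.mem_univ, true_and]
           exact ⟨ha, hdich ha hc hc₀ hca⟩⟩
    (by
      intro h
      have := h ▸ Finset.mem_univ c₀
      simp only [Finset.mem_filter] at this
      exact this.2.1 hc₀)
  simp only [Finset.mem_filter, Finset.mem_univ, true_and, not_and] at ha' hb
  have hbs : b ∉ s.support := fun hbs => hT.1 _ _ hab (hdich ha'.1 hc₀ hbs ha'.2)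
  have hsc : s c₀ ∈ s.support := Equiv.Perm.apply_mem_support.2 hc₀
  refine hno hc₀ ha'.1 hbs ha'.2 (Or.inr hab) ((hT.2 _ _ ?_).resolve_right fun h => ?_)
  · intro h
    exact hbs (h ▸ hsc)
  · exact hb hbs (hdich hbs hsc hc₀ h)

end Camion

/-! ### Breaker's box game -/

section Breaker

variable {V : Type*} [DecidableEq V]

/-- Arcs from `v` to all the vertices of `T`. -/
def star (v : V) (T : Finset V) : Arcs V := T.image fun x => (v, x)

theorem mem_star {v : V} {T : Finset V} {a b : V} : (a, b) ∈ star v T ↔ a = v ∧ b ∈ T := by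
  simp only [star, Finset.mem_image, Prod.mk.injEq]
  constructor
  · rintro ⟨x, hx, rfl, rfl⟩; exact ⟨rfl, hx⟩
  · rintro ⟨rfl, hb⟩; exact ⟨b, hb, rfl, rfl⟩

theorem card_star_le (v : V) (T : Finset V) : (star v T).card ≤ T.card := Finset.card_image_le

variable [Fintype V]

theorem inDegree_eq_zero_iff {D : Arcs V} {v : V} : inDegree D v = 0 ↔ ∀ u, (u, v) ∉ D := by
  simp [inDegree, Finset.filter_eq_empty_iff]

theorem not_hasHamiltonCycle_of_inDegree_eq_zero {D : Arcs V} {v : V} (h : inDegree D v = 0) :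
    ¬ HasHamiltonCycle D := by
  rintro ⟨s, -, -, hs⟩
  have := hs (s.symm v)
  rw [Equiv.apply_symm_apply] at this
  exact inDegree_eq_zero_iff.1 h _ this

/-- The property Breaker aims at. -/
def HasSource (D : Arcs V) : Prop :=
  (∃ v : V, inDegree D v = 0) ∧ ¬ HasHamiltonCycle D

theorem wins_hasSource_of_dominating {p q : ℕ} (hp : 1 ≤ p) {D : Arcs V} (hO : IsOriented D)
    {v : V} (hv : ∀ u, u ≠ v → (v, u) ∈ D) : Wins p q HasSource D := by
  refine wins_of_monotone hp (Q := fun D => ∃ v : V, ∀ u, u ≠ v → (v, u) ∈ D)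
    (fun D D' h => fun ⟨v, hv⟩ => ⟨v, fun u hu => h (hv u hu)⟩) ?_ hO ⟨v, hv⟩
  rintro D hT ⟨v, hv⟩
  have h0 : inDegree D v = 0 := by
    rw [inDegree_eq_zero_iff]
    intro u hu
    exact hT.1 _ _ hu (hv u (hT.1.ne hu))
  exact ⟨⟨v, h0⟩, not_hasHamiltonCycle_of_inDegree_eq_zero h0⟩

/-- The vertices outside `A` to which no arc from `v` leads. -/
def missing (A : Finset V) (D : Arcs V) (v : V) : Finset V :=
  Aᶜ.filter fun x => (v, x) ∉ D

/-- The vertices of `L` have in-degree `0` and each lacks at most `r` arcs to the outside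
of `A`. -/
def Alive (A : Finset V) (D : Arcs V) (L : Finset V) (r : ℕ) : Prop :=
  L ⊆ A ∧ (∀ v ∈ L, ∀ u, (u, v) ∉ D) ∧ ∀ v ∈ L, (missing A D v).card ≤ r

/-- A reply by a single arc kills at most one of the alive vertices. -/
theorem Alive.reply {A L : Finset V} {D D' : Arcs V} {r k : ℕ} (h : Alive A D L r)
    (hk : k + 1 ≤ L.card) (hsub : D ⊆ D') (hcard : (D' \ D).card ≤ 1) :
    ∃ L', L'.card = k ∧ Alive A D' L' r := by
  obtain ⟨w, hw⟩ : ∃ w, ∀ u v, v ∈ L → (u, v) ∈ D' → v = w := by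
    by_cases hL : ∃ u v, v ∈ L ∧ (u, v) ∈ D'
    · obtain ⟨u, w, hwL, huw⟩ := hL
      refine ⟨w, fun u' v hv huv => ?_⟩
      have h1 : (u, w) ∈ D' \ D := Finset.mem_sdiff.2 ⟨huw, h.2.1 w hwL u⟩
      have h2 : (u', v) ∈ D' \ D := Finset.mem_sdiff.2 ⟨huv, h.2.1 v hv u'⟩
      have := Finset.card_le_one.1 hcard _ h1 _ h2
      exact (congrArg Prod.snd this).symm
    · push Not at hL
      obtain ⟨w, -⟩ : L.Nonempty := Finset.card_pos.1 (by omega)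
      exact ⟨w, fun u v hv huv => absurd huv (hL u v hv)⟩
  obtain ⟨L', hL', hcardL'⟩ := Finset.exists_subset_card_eq (s := L.erase w) (n := k)
    (by have := Finset.pred_card_le_card_erase (s := L) (a := w); omega)
  refine ⟨L', hcardL', (hL'.trans (Finset.erase_subset _ _)).trans h.1, fun v hv u huv => ?_,
    fun v hv => ?_⟩
  · have := Finset.mem_erase.1 (hL' hv)
    exact this.1 (hw u v this.2 huv)
  · refine (Finset.card_le_card fun x hx => ?_).trans (h.2.2 v (Finset.mem_of_mem_erase (hL' hv)))
    rw [missing, Finset.mem_filter] at hx ⊢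
    exact ⟨hx.1, fun h => hx.2 (hsub h)⟩

/-- A bound for the number of arcs that `k` alive vertices may lack if Breaker is to win, when
there are `m` candidates. -/
def boxBound (b m k : ℕ) : ℕ := b - m + ∑ j ∈ Finset.Ico 2 (k + 1), b / j

/-- Once a vertex of in-degree `0` lacks few arcs, Breaker orients all of them at once. -/
theorem wins_of_few_missing {A : Finset V} {D : Arcs V} {b : ℕ} (hb : 1 ≤ b) (hO : IsOriented D)
    {v : V} (hv : ∀ u, (u, v) ∉ D) (hmiss : (missing A D v).card + A.card ≤ b) :
    Wins b 1 HasSource D := by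
  set T := Finset.univ.filter fun x => x ≠ v ∧ (v, x) ∉ D with hT
  by_cases hTe : T = ∅
  · refine wins_hasSource_of_dominating hb hO (v := v) fun u hu => ?_
    by_contra h
    have : u ∈ T := by rw [hT, Finset.mem_filter]; exact ⟨Finset.mem_univ _, hu, h⟩
    simp [hTe] at this
  have hTcard : T.card ≤ b := by
    refine (Finset.card_le_card (t := missing A D v ∪ A) fun x hx => ?_).trans
      ((Finset.card_union_le _ _).trans hmiss)
    rw [hT, Finset.mem_filter] at hx
    by_cases hxA : x ∈ A
    · exact Finset.mem_union_right _ hxA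
    · exact Finset.mem_union_left _ (by simp [missing, hxA, hx.2.2])
  have hsd : (D ∪ star v T) \ D = star v T := by
    rw [Finset.union_sdiff_left, Finset.sdiff_eq_self_iff_disjoint, Finset.disjoint_left]
    rintro ⟨x, y⟩ hxy
    obtain ⟨rfl, hy⟩ := mem_star.1 hxy
    exact (Finset.mem_filter.1 hy).2.2
  have hO' : IsOriented (D ∪ star v T) := by
    intro x y hxy hyx
    rw [Finset.mem_union, mem_star] at hxy hyx
    rcases hxy with hxy | ⟨rfl, hy⟩
    · rcases hyx with hyx | ⟨rfl, hx⟩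
      · exact hO _ _ hxy hyx
      · exact hv _ hxy
    · rcases hyx with hyx | ⟨rfl, hx⟩
      · exact hv _ hyx
      · exact (Finset.mem_filter.1 hy).2.1 rfl
  refine .move (D' := D ∪ star v T) ⟨Finset.subset_union_left, hO', ?_, ?_⟩ ?_
  · rw [hsd]
    obtain ⟨x, hx⟩ := Finset.nonempty_iff_ne_empty.2 hTe
    exact Finset.card_pos.2 ⟨(v, x), mem_star.2 ⟨rfl, hx⟩⟩
  · rw [hsd]
    exact (card_star_le _ _).trans hTcard
  · intro D'' hsub hO'' _
    refine wins_hasSource_of_dominating hb hO'' (v := v) fun u hu => hsub ?_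
    by_cases h : (v, u) ∈ D
    · exact Finset.mem_union_left _ h
    · exact Finset.mem_union_right _ (mem_star.2 ⟨rfl, by simp [hT, hu, h]⟩)

/-- Breaker spreads his arcs evenly over the alive vertices, and the reply kills at most one of
them; each round thus pays for one summand `b / j` of `boxBound`. The remaining term `b - m` leaves
room, in the last turn, for the arcs into `A` that were ignored so far. -/
theorem wins_of_alive {A : Finset V} {b : ℕ} (hb : A.card ≤ b) (hb1 : 1 ≤ b) (k : ℕ) :
    ∀ (D : Arcs V) (L : Finset V), IsOriented D → L.card = k + 1 →
      Alive A D L (boxBound b A.card (k + 1)) → Wins b 1 HasSource D := by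
  induction k with
  | zero =>
    intro D L hO hL h
    obtain ⟨v, hv⟩ : L.Nonempty := Finset.card_pos.1 (by omega)
    refine wins_of_few_missing (A := A) hb1 hO (h.2.1 v hv) ?_
    have := h.2.2 v hv
    simp [boxBound] at this
    omega
  | succ k ih =>
    intro D L hO hL h
    by_cases hfew : ∃ v ∈ L, (missing A D v).card + A.card ≤ b
    · obtain ⟨v, hv, hle⟩ := hfew
      exact wins_of_few_missing hb1 hO (h.2.1 v hv) hle
    push Not at hfew
    have hT : ∀ v, ∃ T ⊆ missing A D v, T.card = min (b / (k + 2)) (missing A D v).card :=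
      fun v => Finset.exists_subset_card_eq (min_le_right _ _)
    choose T hTsub hTcard using hT
    set N := L.biUnion fun v => star v (T v) with hN
    have hmemN : ∀ {x y}, (x, y) ∈ N → x ∈ L ∧ y ∈ T x := by
      intro x y hxy
      obtain ⟨v, hv, hxy⟩ := Finset.mem_biUnion.1 hxy
      obtain ⟨rfl, hy⟩ := mem_star.1 hxy
      exact ⟨hv, hy⟩
    have hTA : ∀ {x y}, y ∈ T x → y ∉ A ∧ (x, y) ∉ D := by
      intro x y hy
      have := hTsub x hy
      rw [missing, Finset.mem_filter, Finset.mem_compl] at this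
      exact this
    have hsd : (D ∪ N) \ D = N := by
      rw [Finset.union_sdiff_left, Finset.sdiff_eq_self_iff_disjoint, Finset.disjoint_left]
      rintro ⟨x, y⟩ hxy
      exact (hTA (hmemN hxy).2).2
    have hO' : IsOriented (D ∪ N) := by
      intro x y hxy hyx
      rw [Finset.mem_union] at hxy hyx
      rcases hxy with hxy | hxy
      · rcases hyx with hyx | hyx
        · exact hO _ _ hxy hyx
        · exact h.2.1 y (hmemN hyx).1 _ hxy
      · rcases hyx with hyx | hyx
        · exact h.2.1 x (hmemN hxy).1 _ hyx
        -- Heads of new arcs avoid `A` while tails lie in `A`, so alive vertices never hurt each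
        -- other.
        · exact (hTA (hmemN hxy).2).1 (h.1 (hmemN hyx).1)
    have hkA : k + 2 ≤ A.card := by
      have := Finset.card_le_card h.1
      omega
    refine .move (D' := D ∪ N) ⟨Finset.subset_union_left, hO', ?_, ?_⟩ ?_
    · rw [hsd]
      obtain ⟨v, hv⟩ : L.Nonempty := Finset.card_pos.1 (by omega)
      have h1 := hfew v hv
      have h2 : 1 ≤ b / (k + 2) := (Nat.one_le_div_iff (by omega)).2 (by omega)
      obtain ⟨x, hx⟩ : (T v).Nonempty := Finset.card_pos.1 (by rw [hTcard]; omega)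
      exact Finset.card_pos.2 ⟨(v, x), Finset.mem_biUnion.2 ⟨v, hv, mem_star.2 ⟨rfl, hx⟩⟩⟩
    · rw [hsd]
      calc N.card ≤ ∑ v ∈ L, (star v (T v)).card := Finset.card_biUnion_le
        _ ≤ ∑ v ∈ L, b / (k + 2) := Finset.sum_le_sum fun v _ =>
            (card_star_le _ _).trans (by rw [hTcard]; exact min_le_left _ _)
        _ = (k + 2) * (b / (k + 2)) := by rw [Finset.sum_const, hL, smul_eq_mul]
        _ ≤ b := Nat.mul_div_le _ _
    · intro D'' hsub hO'' hcard
      have hal : Alive A (D ∪ N) L (boxBound b A.card (k + 1)) := by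
        refine ⟨h.1, fun v hv u huv => ?_, fun v hv => ?_⟩
        · rcases Finset.mem_union.1 huv with huv | huv
          · exact h.2.1 v hv u huv
          · exact (hTA (hmemN huv).2).1 (h.1 hv)
        · have h1 : missing A (D ∪ N) v ⊆ missing A D v \ T v := by
            intro x hx
            simp only [missing, Finset.mem_filter, Finset.mem_sdiff, Finset.mem_union, not_or]
              at hx ⊢
            exact ⟨⟨hx.1, hx.2.1⟩, fun hxT => hx.2.2
              (Finset.mem_biUnion.2 ⟨v, hv, mem_star.2 ⟨rfl, hxT⟩⟩)⟩
          have h2 := Finset.card_le_card h1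
          rw [Finset.card_sdiff_of_subset (hTsub v), hTcard] at h2
          have h3 := h.2.2 v hv
          have h4 : boxBound b A.card (k + 1 + 1) = boxBound b A.card (k + 1) + b / (k + 2) := by
            rw [boxBound, boxBound, Finset.sum_Ico_succ_top (by omega), add_assoc]
          omega
      obtain ⟨L', hL', hal'⟩ := hal.reply (k := k + 1) (by omega) hsub hcard
      exact ih D'' L' hO'' hL' hal'

theorem breakerCanForce_hasSource {b m : ℕ} (hm2 : 2 ≤ m) (hmb : m ≤ b)
    (hmn : m ≤ Fintype.card V) (hbox : Fintype.card V - m ≤ boxBound b m (m - 1)) :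
    BreakerCanForce V 1 b HasSource := by
  refine breakerCanForce_of_wins (by omega) fun D hO hD => ?_
  obtain ⟨A, -, hA⟩ := Finset.exists_subset_card_eq (s := (Finset.univ : Finset V)) (n := m) hmn
  have h0 : Alive A (∅ : Arcs V) A (boxBound b A.card (m - 1)) := by
    refine ⟨subset_rfl, by simp, fun v _ => ?_⟩
    refine (Finset.card_filter_le _ _).trans ?_
    rw [Finset.card_compl, hA]
    exact hbox
  -- Maker's opening arc counts as a reply to the empty position; it costs one of the `m`
  -- candidates.
  obtain ⟨L, hL, hal⟩ := h0.reply (k := m - 1) (by omega) (Finset.empty_subset D) (by simpa)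
  obtain ⟨k, rfl⟩ : ∃ k, m = k + 2 := ⟨m - 2, by omega⟩
  exact wins_of_alive (by omega) (by omega) k D L hO hL hal

end Breaker

/-! ### Crossing the large cuts -/

section LargeCuts

variable {V : Type*}

/-- Some arc leaves `S`. -/
def Crosses (D : Arcs V) (S : Finset V) : Prop := ∃ u ∈ S, ∃ v ∉ S, (u, v) ∈ D

theorem Crosses.mono {D D' : Arcs V} {S : Finset V} (h : Crosses D S) (hD : D ⊆ D') :
    Crosses D' S := by
  obtain ⟨u, hu, v, hv, huv⟩ := h
  exact ⟨u, hu, v, hv, hD huv⟩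

variable [DecidableEq V]

theorem card_le_of_reply {D D' D'' : Arcs V} {b : ℕ} (h' : (D' \ D).card ≤ 1)
    (h'' : (D'' \ D').card ≤ b) : (D'' \ D).card ≤ b + 1 := by
  have h1 : D'' \ D ⊆ (D'' \ D') ∪ (D' \ D) := by
    intro x hx
    simp only [Finset.mem_union, Finset.mem_sdiff] at hx ⊢
    tauto
  have := Finset.card_le_card h1
  have := Finset.card_union_le (D'' \ D') (D' \ D)
  omega

variable [Fintype V]

/-- Every set of at most `t` vertices is entered and left by an arc. -/
def SmallCutsCrossed (t : ℕ) (D : Arcs V) : Prop :=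
  ∀ S : Finset V, S.Nonempty → S.card ≤ t → Crosses D S ∧ Crosses D Sᶜ

open Classical in
/-- The sets that are not left by an arc, neither they nor their complements being small. -/
noncomputable def uncrossed (t : ℕ) (D : Arcs V) : Finset (Finset V) :=
  Finset.univ.filter fun S => t < S.card ∧ t < Sᶜ.card ∧ ¬ Crosses D S

theorem mem_uncrossed {t : ℕ} {D : Arcs V} {S : Finset V} :
    S ∈ uncrossed t D ↔ t < S.card ∧ t < Sᶜ.card ∧ ¬ Crosses D S := by
  simp [uncrossed]

theorem cutsCrossed_of_uncrossed_eq_empty {t : ℕ} {D : Arcs V} (hs : SmallCutsCrossed t D)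
    (hu : uncrossed t D = ∅) : CutsCrossed D := by
  intro S hS hS'
  by_cases h1 : S.card ≤ t
  · exact (hs S hS h1).1
  by_cases h2 : Sᶜ.card ≤ t
  · have := (hs Sᶜ (by rwa [Finset.nonempty_iff_ne_empty, Ne, Finset.compl_eq_empty_iff]) h2).2
    rwa [compl_compl] at this
  by_contra hc
  have : S ∈ uncrossed t D := mem_uncrossed.2 ⟨by omega, by omega, hc⟩
  simp [hu] at this

theorem wins_hasHamiltonCycle_of_cutsCrossed {p q : ℕ} (hp : 1 ≤ p) (hV : 1 < Fintype.card V)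
    {D : Arcs V} (hO : IsOriented D) (hD : CutsCrossed D) : Wins p q HasHamiltonCycle D :=
  wins_of_monotone hp (Q := CutsCrossed)
    (fun _ _ h hD S hS hS' => (show Crosses _ S from hD S hS hS').mono h)
    (fun _ hT hD => hT.hasHamiltonCycle hD hV) hO hD

/-- The arcs leaving `S` that may still be created. -/
def freeCut (D : Arcs V) (S : Finset V) : Finset (V × V) :=
  (S ×ˢ Sᶜ).filter fun x => x ∉ D ∧ x.swap ∉ D

/-- A pair in `S × Sᶜ` that is not free has its reverse in `D`, as no arc leaves `S`. -/
theorem le_card_freeCut {D : Arcs V} {S : Finset V} (h : ¬ Crosses D S) :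
    S.card * Sᶜ.card ≤ (freeCut D S).card + D.card := by
  rw [← Finset.card_product, ← Finset.card_map (s := D) ⟨Prod.swap, Prod.swap_injective⟩]
  refine (Finset.card_le_card fun x hx => ?_).trans (Finset.card_union_le _ _)
  rw [Finset.mem_union]
  by_cases hxD : x.swap ∈ D
  · exact Or.inr (Finset.mem_map.2 ⟨x.swap, hxD, by simp⟩)
  · refine Or.inl (Finset.mem_filter.2 ⟨hx, fun hx' => h ?_, hxD⟩)
    rw [Finset.mem_product, Finset.mem_compl] at hx
    exact ⟨x.1, hx.1, x.2, hx.2, hx'⟩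

/-- Maker can create an arc that crosses a constant proportion of the uncrossed cuts. -/
theorem exists_crossing_arc {t E : ℕ} {θ : ℝ} (hθ : 0 < θ) (hθE : θ * (Fintype.card V) ^ 2 ≤ E)
    (hmid : ∀ S : Finset V, t < S.card → t < Sᶜ.card → 2 * E ≤ S.card * Sᶜ.card)
    {D : Arcs V} (hD : D.card ≤ E) (hU : (uncrossed t D).Nonempty) :
    ∃ x : V × V, x.1 ≠ x.2 ∧ x ∉ D ∧ x.swap ∉ D ∧
      ((uncrossed t (insert x D)).card : ℝ) ≤ (1 - θ) * (uncrossed t D).card := by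
  classical
  have hfree : ∀ S ∈ uncrossed t D, E ≤ (freeCut D S).card := by
    intro S hS
    obtain ⟨h1, h2, h3⟩ := mem_uncrossed.1 hS
    have := le_card_freeCut h3
    have := hmid S h1 h2
    omega
  have hn : 0 < Fintype.card V := by
    obtain ⟨S, hS⟩ := hU
    have := (mem_uncrossed.1 hS).1
    have := Finset.card_le_univ S
    omega
  -- Double counting of the pairs of an uncrossed set and a free arc leaving it; some arc reaches
  -- the average.
  have hcount := Finset.sum_card_bipartiteAbove_eq_sum_card_bipartiteBelow
    (s := (Finset.univ : Finset (V × V))) (t := uncrossed t D) (fun x S => x ∈ freeCut D S)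
  have hlow : (uncrossed t D).card * E ≤ ∑ x : V × V,
      (Finset.bipartiteAbove (fun x S => x ∈ freeCut D S) (uncrossed t D) x).card := by
    rw [hcount, ← smul_eq_mul]
    refine Finset.card_nsmul_le_sum _ _ _ fun S hS => (hfree S hS).trans (le_of_eq ?_)
    congr 1
    ext x
    simp [Finset.bipartiteBelow]
  have hn2 : (0 : ℝ) < (Fintype.card V : ℝ) ^ 2 := by positivity
  have hlow' : ∑ _x : V × V, θ * ((uncrossed t D).card : ℝ) ≤ ∑ x : V × V,
      ((Finset.bipartiteAbove (fun x S => x ∈ freeCut D S) (uncrossed t D) x).card : ℝ) := by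
    rw [Finset.sum_const, Finset.card_univ, Fintype.card_prod, nsmul_eq_mul]
    have h1 : (((uncrossed t D).card * E : ℕ) : ℝ) ≤ _ := Nat.cast_le.2 hlow
    push_cast at h1 ⊢
    refine le_trans ?_ h1
    have : (0 : ℝ) ≤ (uncrossed t D).card := by positivity
    nlinarith
  have : Nonempty (V × V) := by
    obtain ⟨v⟩ := Fintype.card_pos_iff.1 hn
    exact ⟨(v, v)⟩
  obtain ⟨x, -, hx⟩ := Finset.exists_le_of_sum_le Finset.univ_nonempty hlow'
  have hpos : (0 : ℝ) < (uncrossed t D).card := by exact_mod_cast Finset.card_pos.2 hU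
  obtain ⟨S, hS⟩ : (Finset.bipartiteAbove (fun x S => x ∈ freeCut D S)
      (uncrossed t D) x).Nonempty := by
    rw [← Finset.card_pos]
    exact_mod_cast lt_of_lt_of_le (mul_pos hθ hpos) hx
  have hxS : x ∈ freeCut D S := (Finset.mem_filter.1 hS).2
  have hxS' := Finset.mem_filter.1 hxS
  refine ⟨x, ?_, hxS'.2.1, hxS'.2.2, ?_⟩
  · rw [Finset.mem_product, Finset.mem_compl] at hxS'
    intro h
    exact hxS'.1.2 (h ▸ hxS'.1.1)
  · have hsub : uncrossed t (insert x D) ⊆ uncrossed t D \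
        Finset.bipartiteAbove (fun x S => x ∈ freeCut D S) (uncrossed t D) x := by
      intro S' hS'
      have h' := mem_uncrossed.1 hS'
      refine Finset.mem_sdiff.2 ⟨mem_uncrossed.2 ⟨h'.1, h'.2.1, fun hc =>
        h'.2.2 (hc.mono (Finset.subset_insert _ _))⟩, fun hb => h'.2.2 ?_⟩
      have := (Finset.mem_filter.1 (Finset.mem_filter.1 hb).2).1
      rw [Finset.mem_product, Finset.mem_compl] at this
      exact ⟨x.1, this.1, x.2, this.2, Finset.mem_insert_self _ _⟩
    have h1 := Finset.card_le_card hsub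
    have h2 := Finset.card_sdiff_add_card_eq_card (s := Finset.bipartiteAbove
      (fun x S => x ∈ freeCut D S) (uncrossed t D) x) (t := uncrossed t D)
      (Finset.filter_subset _ _)
    have h3 : ((uncrossed t (insert x D)).card : ℝ) + (Finset.bipartiteAbove
      (fun x S => x ∈ freeCut D S) (uncrossed t D) x).card ≤ (uncrossed t D).card := by
      exact_mod_cast (by omega)
    linarith

theorem uncrossed_anti {t : ℕ} {D D' : Arcs V} (h : D ⊆ D') : uncrossed t D' ⊆ uncrossed t D := by
  intro S hS
  rw [mem_uncrossed] at hS ⊢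
  exact ⟨hS.1, hS.2.1, fun hc => hS.2.2 (hc.mono h)⟩

theorem SmallCutsCrossed.mono {t : ℕ} {D D' : Arcs V} (hs : SmallCutsCrossed t D) (h : D ⊆ D') :
    SmallCutsCrossed t D' :=
  fun S hS hS' => ⟨(hs S hS hS').1.mono h, (hs S hS hS').2.mono h⟩

/-- If the small cuts are crossed and few edges are oriented, Maker can cross all the cuts. -/
theorem wins_of_smallCutsCrossed {t E b : ℕ} {θ : ℝ} (hV : 1 < Fintype.card V) (hθ : 0 < θ)
    (hθ1 : θ ≤ 1) (hθE : θ * (Fintype.card V) ^ 2 ≤ E)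
    (hmid : ∀ S : Finset V, t < S.card → t < Sᶜ.card → 2 * E ≤ S.card * Sᶜ.card) (m : ℕ) :
    ∀ D : Arcs V, IsOriented D → SmallCutsCrossed t D → D.card + m * (b + 1) ≤ E →
      ((uncrossed t D).card : ℝ) * (1 - θ) ^ m < 1 → Wins 1 b HasHamiltonCycle D := by
  induction m with
  | zero =>
    intro D hO hs _ hU
    refine wins_hasHamiltonCycle_of_cutsCrossed le_rfl hV hO
      (cutsCrossed_of_uncrossed_eq_empty hs ?_)
    rw [pow_zero, mul_one] at hU
    rw [← Finset.card_eq_zero]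
    exact_mod_cast (Nat.lt_one_iff.1 (by exact_mod_cast hU))
  | succ m ih =>
    intro D hO hs hE hU
    by_cases hne : uncrossed t D = ∅
    · exact wins_hasHamiltonCycle_of_cutsCrossed le_rfl hV hO
        (cutsCrossed_of_uncrossed_eq_empty hs hne)
    obtain ⟨⟨u, v⟩, huv, h1, h2, h3⟩ := exists_crossing_arc hθ hθE hmid (D := D)
      ((Nat.le_add_right _ _).trans hE) (Finset.nonempty_iff_ne_empty.2 hne)
    have hL := legalMove_insert hO huv h1 h2 (le_refl 1)
    refine .move hL fun D'' hsub hO'' hcard => ih D'' hO'' (hs.mono (hL.1.trans hsub)) ?_ ?_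
    · have h4 := card_le_of_reply hL.2.2.2 hcard
      have h5 := Finset.card_sdiff_add_card_eq_card (hL.1.trans hsub)
      have h6 : (m + 1) * (b + 1) = m * (b + 1) + (b + 1) := by ring
      omega
    · refine lt_of_le_of_lt ?_ hU
      have h4 : ((uncrossed t D'').card : ℝ) ≤ (1 - θ) * (uncrossed t D).card :=
        (Nat.cast_le.2 (Finset.card_le_card (uncrossed_anti hsub))).trans h3
      calc ((uncrossed t D'').card : ℝ) * (1 - θ) ^ m
          ≤ (1 - θ) * (uncrossed t D).card * (1 - θ) ^ m :=
            mul_le_mul_of_nonneg_right h4 (pow_nonneg (by linarith) _)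
        _ = _ := by ring

end LargeCuts

/-! ### Danger and degrees of untreated vertices -/

section DegreeGame

variable {V : Type*} [DecidableEq V]

/-- The arcs with an endpoint in `J`. -/
def incident (D : Arcs V) (J : Finset V) : Arcs V := D.filter fun x => x.1 ∈ J ∨ x.2 ∈ J

theorem mem_incident {D : Arcs V} {J : Finset V} {x : V × V} :
    x ∈ incident D J ↔ x ∈ D ∧ (x.1 ∈ J ∨ x.2 ∈ J) := Finset.mem_filter

/-- The number of arcs at `v`. -/
def degree (D : Arcs V) (v : V) : ℕ := (incident D {v}).card

theorem card_incident_le_add {D D' : Arcs V} (J : Finset V) :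
    (incident D' J).card ≤ (incident D J).card + (incident (D' \ D) J).card := by
  refine (Finset.card_le_card fun x hx => ?_).trans (Finset.card_union_le _ _)
  rw [Finset.mem_union, mem_incident, mem_incident, Finset.mem_sdiff]
  rw [mem_incident] at hx
  tauto

theorem sum_degree_le (D : Arcs V) (J : Finset V) : ∑ v ∈ J, degree D v ≤ 2 * D.card := by
  have h := Finset.sum_card_bipartiteAbove_eq_sum_card_bipartiteBelow
    (s := J) (t := D) (fun v x => x.1 = v ∨ x.2 = v)
  have h1 : ∑ v ∈ J, degree D v = ∑ v ∈ J,
      (Finset.bipartiteAbove (fun v x => x.1 = v ∨ x.2 = v) D v).card := by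
    refine Finset.sum_congr rfl fun v _ => ?_
    rw [degree]
    congr 1
    ext x
    simp [mem_incident, Finset.bipartiteAbove]
  rw [h1, h, mul_comm, ← smul_eq_mul]
  refine Finset.sum_le_card_nsmul _ _ _ fun x _ => ?_
  refine (Finset.card_le_card (t := {x.1, x.2}) fun v hv => ?_).trans Finset.card_le_two
  simp only [Finset.bipartiteBelow, Finset.mem_filter] at hv
  rw [Finset.mem_insert, Finset.mem_singleton]
  tauto

theorem card_incident_le_sum_degree (D : Arcs V) (J : Finset V) :
    (incident D J).card ≤ ∑ v ∈ J, degree D v := by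
  refine (Finset.card_le_card fun x hx => ?_).trans
    (Finset.card_biUnion_le (s := J) (t := fun v => incident D {v}))
  rw [mem_incident] at hx
  rw [Finset.mem_biUnion]
  rcases hx.2 with h | h
  · exact ⟨x.1, h, mem_incident.2 ⟨hx.1, by simp⟩⟩
  · exact ⟨x.2, h, mem_incident.2 ⟨hx.1, by simp⟩⟩

/-- Only arcs between `v` and `J` are counted twice on the left, and each vertex of `J` has at most
one of them. -/
theorem card_incident_add_degree_le {D : Arcs V} (hO : IsOriented D) {J : Finset V} {v : V}
    (hv : v ∉ J) :
    (incident D J).card + degree D v ≤ (incident D (insert v J)).card + J.card := by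
  rw [degree, ← Finset.card_union_add_card_inter]
  refine add_le_add (Finset.card_le_card fun x hx => ?_) ?_
  · rw [Finset.mem_union, mem_incident, mem_incident] at hx
    rw [mem_incident]
    simp only [Finset.mem_singleton, Finset.mem_insert] at hx ⊢
    tauto
  · have key : ∀ x ∈ incident D J ∩ incident D {v},
        x ∈ D ∧ ((x.1 = v ∧ x.2 ≠ v ∧ x.2 ∈ J) ∨ (x.1 ≠ v ∧ x.2 = v ∧ x.1 ∈ J)) := by
      intro x hx
      rw [Finset.mem_inter, mem_incident, mem_incident, Finset.mem_singleton,
        Finset.mem_singleton] at hx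
      have h1 : x.1 ∈ J → x.1 ≠ v := fun h h' => hv (h' ▸ h)
      have h2 : x.2 ∈ J → x.2 ≠ v := fun h h' => hv (h' ▸ h)
      tauto
    refine Finset.card_le_card_of_injOn (fun x => if x.1 = v then x.2 else x.1) ?_ ?_
    · intro x hx
      rcases (key x hx).2 with ⟨h1, h2, h3⟩ | ⟨h1, h2, h3⟩
      · simpa [h1] using h3
      · simpa [h1] using h3
    · rintro ⟨a, b⟩ hx ⟨c, d⟩ hy hxy
      have hx := key _ hx
      have hy := key _ hy
      rcases hx with ⟨hxD, ⟨h1, h2, h3⟩ | ⟨h1, h2, h3⟩⟩ <;>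
        rcases hy with ⟨hyD, ⟨k1, k2, k3⟩ | ⟨k1, k2, k3⟩⟩ <;>
        simp only at h1 h2 h3 k1 k2 k3 <;> simp only [h1, k1, if_true, if_false] at hxy
      · rw [h1, k1, hxy]
      · subst h1 k2 hxy; exact absurd hyD (hO _ _ hxD)
      · subst h2 k1 hxy; exact absurd hyD (hO _ _ hxD)
      · rw [h2, k2, hxy]

/-- The danger of a vertex that has been treated `h` times. -/
noncomputable def danger (q : ℕ) (D : Arcs V) (h : V → ℕ) (v : V) : ℝ :=
  degree D v - 2 * q * h v

/-- Bound for the average danger of `k` vertices. -/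
noncomputable def dangerBound (q n k : ℕ) : ℝ := 2 * q * ∑ j ∈ Finset.Ico k n, (1 : ℝ) / j

/-- Bound for the average contribution of `k ≤ K` vertices when the edges among them are counted
only once. -/
noncomputable def incidentBound (q n K k : ℕ) : ℝ :=
  dangerBound q n K + ∑ j ∈ Finset.Ico k K, (1 + (q : ℝ) / j)

theorem dangerBound_succ {q n k : ℕ} (hk : 0 < k) (hkn : k < n) :
    k * dangerBound q n k = k * dangerBound q n (k + 1) + 2 * q := by
  have : (k : ℝ) ≠ 0 := by positivity
  rw [dangerBound, dangerBound, Finset.sum_eq_sum_Ico_succ_bot hkn]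
  field_simp
  ring

theorem incidentBound_succ {q n K k : ℕ} (hk : 0 < k) (hkK : k < K) :
    k * incidentBound q n K k = k * incidentBound q n K (k + 1) + k + q := by
  have : (k : ℝ) ≠ 0 := by positivity
  rw [incidentBound, incidentBound, Finset.sum_eq_sum_Ico_succ_bot hkK]
  field_simp
  ring

/-- The invariant Maker maintains for the vertices `W` that still need treatment. -/
structure Balanced (q n K : ℕ) (D : Arcs V) (h : V → ℕ) (W : Finset V) : Prop where
  sum_le : ∀ J ⊆ W, ∑ v ∈ J, danger q D h v ≤ J.card * dangerBound q n J.card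
  incident_le : ∀ J ⊆ W, J.card ≤ K →
    ((incident D J).card : ℝ) - 2 * q * ∑ v ∈ J, (h v : ℝ) ≤ J.card * incidentBound q n K J.card

theorem balanced_empty (q n K : ℕ) (W : Finset V) :
    Balanced q n K ∅ (fun _ => 0) W := by
  have h1 : ∀ k, 0 ≤ dangerBound q n k := fun k => by unfold dangerBound; positivity
  have h2 : ∀ k, 0 ≤ incidentBound q n K k := fun k => by
    unfold incidentBound
    have := h1 K
    positivity
  constructor
  · intro J _
    have := h1 J.card
    simp only [danger, degree, incident, Finset.filter_empty]
    simp only [Finset.card_empty, Nat.cast_zero, mul_zero, sub_zero, Finset.sum_const_zero]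
    positivity
  · intro J _ _
    have := h2 J.card
    simp only [incident, Finset.filter_empty]
    simp only [Finset.card_empty, Nat.cast_zero, mul_zero, sub_zero, Finset.sum_const_zero]
    positivity

theorem sum_danger (q : ℕ) (D : Arcs V) (h : V → ℕ) (J : Finset V) :
    ∑ v ∈ J, danger q D h v = ((∑ v ∈ J, degree D v : ℕ) : ℝ) - 2 * q * ∑ v ∈ J, (h v : ℝ) := by
  simp only [danger, Finset.sum_sub_distrib, Finset.mul_sum, Nat.cast_sum]

theorem sum_degree_le_add {D D' : Arcs V} (J : Finset V) :
    ∑ v ∈ J, degree D' v ≤ ∑ v ∈ J, degree D v + 2 * (D' \ D).card := by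
  refine le_trans ?_ (Nat.add_le_add_left (sum_degree_le (D' \ D) J) _)
  rw [← Finset.sum_add_distrib]
  exact Finset.sum_le_sum fun v _ => card_incident_le_add {v}

/-- Treating a vertex of maximal danger maintains the invariant. -/
theorem Balanced.step [Fintype V] {q K : ℕ} {D D' : Arcs V} {h h' : V → ℕ} {W W' : Finset V}
    (hB : Balanced q (Fintype.card V) K D h W) (hO : IsOriented D) {v : V} (hv : v ∈ W)
    (hmax : ∀ w ∈ W, danger q D h w ≤ danger q D h v) (hcard : (D' \ D).card ≤ q) (hW : W' ⊆ W)
    (hle : ∀ w, h w ≤ h' w) (hlt : h v + 1 ≤ h' v) :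
    Balanced q (Fintype.card V) K D' h' W' := by
  have hq0 : (0 : ℝ) ≤ q := Nat.cast_nonneg q
  have hcard' : ((D' \ D).card : ℝ) ≤ q := by exact_mod_cast hcard
  have hdeg : ∀ J : Finset V, ((∑ v ∈ J, degree D' v : ℕ) : ℝ) ≤
      ((∑ v ∈ J, degree D v : ℕ) : ℝ) + 2 * q := by
    intro J
    have : ((∑ v ∈ J, degree D' v : ℕ) : ℝ) ≤ _ := Nat.cast_le.2 (sum_degree_le_add (D := D) J)
    push_cast at this ⊢
    linarith
  have hinc : ∀ J : Finset V, ((incident D' J).card : ℝ) ≤ (incident D J).card + q := by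
    intro J
    have h1 := card_incident_le_add (D := D) (D' := D') J
    have h2 : (incident (D' \ D) J).card ≤ (D' \ D).card := Finset.card_filter_le _ _
    exact_mod_cast (by omega)
  have hsum : ∀ J : Finset V, ∑ w ∈ J, (h w : ℝ) ≤ ∑ w ∈ J, (h' w : ℝ) := fun J =>
    Finset.sum_le_sum fun w _ => by exact_mod_cast hle w
  have hsum' : ∀ J : Finset V, v ∈ J → ∑ w ∈ J, (h w : ℝ) + 1 ≤ ∑ w ∈ J, (h' w : ℝ) := by
    intro J hvJ
    rw [← Finset.add_sum_erase J _ hvJ, ← Finset.add_sum_erase J _ hvJ]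
    have h1 := hsum (J.erase v)
    have h2 : (h v : ℝ) + 1 ≤ h' v := by exact_mod_cast hlt
    linarith
  have hfirst : ∀ J ⊆ W', ∑ w ∈ J, danger q D' h' w ≤
      J.card * dangerBound q (Fintype.card V) J.card := by
    intro J hJ
    rw [sum_danger]
    by_cases hvJ : v ∈ J
    -- If `v ∈ J`, the new treatment lowers the sum by `2 * q`, which pays for all new arcs.
    · refine le_trans ?_ (hB.sum_le J (hJ.trans hW))
      rw [sum_danger]
      nlinarith [hdeg J, hsum' J hvJ]
    · rcases J.eq_empty_or_nonempty with rfl | hJne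
      · simp
      have hk : 0 < J.card := hJne.card_pos
      -- As `v` has maximal danger, the average over `J` is at most that over `insert v J`; the new
      -- arcs add at most `2 * q` to the sum.
      have hkn : J.card < Fintype.card V :=
        Finset.card_lt_univ_of_notMem hvJ
      have h1 := hB.sum_le (insert v J) (Finset.insert_subset hv (hJ.trans hW))
      rw [Finset.sum_insert hvJ, Finset.card_insert_of_notMem hvJ] at h1
      have h2 : ∑ w ∈ J, danger q D h w ≤ J.card * danger q D h v := by
        rw [← nsmul_eq_mul]
        exact Finset.sum_le_card_nsmul _ _ _ fun w hw => hmax w (hW (hJ hw))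
      rw [dangerBound_succ hk hkn]
      have h3 := sum_danger q D h J
      have hk' : (1 : ℝ) ≤ J.card := by exact_mod_cast hk
      set A := ∑ w ∈ J, danger q D h w
      set B := dangerBound q (Fintype.card V) (J.card + 1)
      have h4 : A ≤ J.card * B := by
        push_cast at h1
        have : (J.card + 1 : ℝ) * A ≤ (J.card + 1) * (J.card * B) := by nlinarith
        exact le_of_mul_le_mul_left this (by positivity)
      nlinarith [hdeg J, hsum J]
  refine ⟨hfirst, fun J hJ hJK => ?_⟩
  by_cases hvJ : v ∈ J
  · refine le_trans ?_ (hB.incident_le J (hJ.trans hW) hJK)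
    nlinarith [hinc J, hsum' J hvJ]
  · rcases J.eq_empty_or_nonempty with rfl | hJne
    · simp [incident]
    have hk : 0 < J.card := hJne.card_pos
    -- At size `K` the danger sum, which counts inner edges twice, is good enough; below `K` the set
    -- is compared with `insert v J`.
    rcases hJK.eq_or_lt with hJK | hJK
    · have h1 := hfirst J hJ
      rw [sum_danger] at h1
      have h2 : ((incident D' J).card : ℝ) ≤ _ := Nat.cast_le.2 (card_incident_le_sum_degree D' J)
      rw [incidentBound, hJK, Finset.Ico_self, Finset.sum_empty, add_zero]
      rw [hJK] at h1
      linarith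
    · have h1 := hB.incident_le (insert v J) (Finset.insert_subset hv (hJ.trans hW))
        (by rw [Finset.card_insert_of_notMem hvJ]; omega)
      rw [Finset.sum_insert hvJ, Finset.card_insert_of_notMem hvJ] at h1
      have h2 : ∑ w ∈ J, danger q D h w ≤ J.card * danger q D h v := by
        rw [← nsmul_eq_mul]
        exact Finset.sum_le_card_nsmul _ _ _ fun w hw => hmax w (hW (hJ hw))
      rw [sum_danger] at h2
      have h3 : ((incident D J).card : ℝ) ≤ _ := Nat.cast_le.2 (card_incident_le_sum_degree D J)
      have h4 : ((incident D J).card : ℝ) + degree D v ≤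
          (incident D (insert v J)).card + J.card := by
        exact_mod_cast card_incident_add_degree_le hO hvJ
      rw [incidentBound_succ hk hJK]
      have hd : danger q D h v = degree D v - 2 * q * h v := rfl
      have hk' : (1 : ℝ) ≤ J.card := by exact_mod_cast hk
      set A := ((incident D J).card : ℝ) - 2 * q * ∑ w ∈ J, (h w : ℝ) with hA
      set B := incidentBound q (Fintype.card V) K (J.card + 1)
      -- The averaging argument again; the `+ 1` covers the at most `J.card` edges between `v` and
      -- `J`.
      have h5 : A ≤ J.card * (B + 1) := by
        have h6 : A ≤ J.card * danger q D h v := by linarith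
        have h7 : A + danger q D h v ≤ (J.card + 1) * B + J.card := by
          push_cast at h1
          rw [hd, hA]
          linarith
        have : (J.card + 1 : ℝ) * A ≤ (J.card + 1) * (J.card * (B + 1)) := by nlinarith
        exact le_of_mul_le_mul_left this (by positivity)
      nlinarith [hinc J, hsum J]

theorem Balanced.degree_le {q n K : ℕ} {D : Arcs V} {h : V → ℕ} {W : Finset V}
    (hB : Balanced q n K D h W) (hK : 1 ≤ K) {v : V} (hv : v ∈ W) :
    (degree D v : ℝ) ≤ incidentBound q n K 1 + 2 * q * h v := by
  have := hB.incident_le {v} (by simpa) (by simpa)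
  rw [Finset.sum_singleton, Finset.card_singleton, Nat.cast_one, one_mul] at this
  rw [degree]
  linarith

/-- The vertices whose edge to `v` is undirected. -/
def available [Fintype V] (D : Arcs V) (v : V) : Finset V :=
  Finset.univ.filter fun x => x ≠ v ∧ (x, v) ∉ D ∧ (v, x) ∉ D

theorem card_le_available_add_degree [Fintype V] (D : Arcs V) (v : V) :
    Fintype.card V ≤ (available D v).card + degree D v + 1 := by
  have h : (Finset.univ : Finset V) ⊆ (available D v ∪
      (incident D {v}).image fun x => if x.1 = v then x.2 else x.1) ∪ {v} := by
    intro x _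
    by_cases hxv : x = v
    · simp [hxv]
    by_cases h1 : (x, v) ∈ D
    · refine Finset.mem_union_left _ (Finset.mem_union_right _ (Finset.mem_image.2 ⟨(x, v), ?_, ?_⟩))
      · simp [mem_incident, h1]
      · simp [hxv]
    by_cases h2 : (v, x) ∈ D
    · refine Finset.mem_union_left _ (Finset.mem_union_right _ (Finset.mem_image.2 ⟨(v, x), ?_, ?_⟩))
      · simp [mem_incident, h2]
      · simp
    · exact Finset.mem_union_left _ (Finset.mem_union_left _ (by simp [available, hxv, h1, h2]))
  have h1 := Finset.card_le_card h
  have h2 := Finset.card_union_le (available D v ∪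
      (incident D {v}).image fun x => if x.1 = v then x.2 else x.1) {v}
  have h3 := Finset.card_union_le (available D v)
      ((incident D {v}).image fun x => if x.1 = v then x.2 else x.1)
  have h4 : ((incident D {v}).image fun x => if x.1 = v then x.2 else x.1).card ≤
    (incident D {v}).card := Finset.card_image_le
  rw [Finset.card_univ] at h1
  rw [Finset.card_singleton] at h2
  rw [degree]
  omega

end DegreeGame

/-! ### The potential of small uncrossed sets -/

section Potential

variable {V : Type*}

/-- The places to be filled for a vertex: two in-neighbours (`true`) and two out-neighbours
(`false`). -/
abbrev Slot (V : Type*) := V × Bool × Bool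

/-- The slots of direction `τ` at the vertices of `S`. -/
def slots (τ : Bool) (S : Finset V) : Finset (Slot V) := S ×ˢ {τ} ×ˢ Finset.univ

theorem mem_slots {τ : Bool} {S : Finset V} {s : Slot V} :
    s ∈ slots τ S ↔ s.1 ∈ S ∧ s.2.1 = τ := by
  rw [slots, Finset.mem_product, Finset.mem_product, Finset.mem_singleton]
  simp

variable [DecidableEq V]

/-- The estimated probability that a slot is filled with an element of `S`. -/
noncomputable def slotWeight (p : ℝ) (S : Finset V) : Option V → ℝ
  | none => p * S.card
  | some x => if x ∈ S then 1 else 0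

/-- The estimated probability that all slots at `S` are filled with elements of `S`. -/
noncomputable def weight (p : ℝ) (f : Slot V → Option V) (τ : Bool) (S : Finset V) : ℝ :=
  ∏ s ∈ slots τ S, slotWeight p S (f s)

theorem slotWeight_nonneg {p : ℝ} (hp : 0 ≤ p) (S : Finset V) (o : Option V) :
    0 ≤ slotWeight p S o := by
  cases o with
  | none => exact mul_nonneg hp (Nat.cast_nonneg _)
  | some x => simp only [slotWeight]; split_ifs <;> norm_num

theorem weight_nonneg {p : ℝ} (hp : 0 ≤ p) (f : Slot V → Option V) (τ : Bool) (S : Finset V) :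
    0 ≤ weight p f τ S :=
  Finset.prod_nonneg fun _ _ => slotWeight_nonneg hp _ _

/-- A uniformly random element of `A` lies in `S` with probability at most `S.card / A.card ≤ p *
S.card`, the factor of an empty slot. So the weight does not increase on average. -/
theorem sum_weight_update_le {p : ℝ} (hp : 0 ≤ p) {f : Slot V → Option V} {s : Slot V}
    (hs : f s = none) {A : Finset V} (hA : 1 ≤ p * A.card) (τ : Bool) (S : Finset V) :
    ∑ x ∈ A, weight p (Function.update f s (some x)) τ S ≤ ∑ _x ∈ A, weight p f τ S := by
  by_cases hmem : s ∈ slots τ S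
  · have hrest : ∀ g : Slot V → Option V, (∀ s' ≠ s, g s' = f s') → weight p g τ S =
        slotWeight p S (g s) * ∏ s' ∈ (slots τ S).erase s, slotWeight p S (f s') := by
      intro g hg
      rw [weight, ← Finset.mul_prod_erase _ _ hmem]
      congr 1
      exact Finset.prod_congr rfl fun s' hs' => by rw [hg s' (Finset.ne_of_mem_erase hs')]
    have h1 : ∀ x, weight p (Function.update f s (some x)) τ S = (if x ∈ S then 1 else 0) *
        ∏ s' ∈ (slots τ S).erase s, slotWeight p S (f s') := by
      intro x
      rw [hrest _ fun s' hs' => Function.update_of_ne hs' _ _, Function.update_self]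
      rfl
    rw [Finset.sum_congr rfl fun x _ => h1 x, hrest f (fun _ _ => rfl), hs, ← Finset.sum_mul,
      Finset.sum_const, nsmul_eq_mul, ← mul_assoc]
    refine mul_le_mul_of_nonneg_right ?_ (Finset.prod_nonneg fun _ _ => slotWeight_nonneg hp _ _)
    rw [Finset.sum_boole, slotWeight]
    have h2 : ((A.filter fun x => x ∈ S).card : ℝ) ≤ S.card := by
      exact_mod_cast Finset.card_le_card fun x hx => (Finset.mem_filter.1 hx).2
    have h3 : (0 : ℝ) ≤ S.card := Nat.cast_nonneg _
    nlinarith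
  · refine Finset.sum_le_sum fun x _ => le_of_eq (Finset.prod_congr rfl fun s' hs' => ?_)
    rw [Function.update_of_ne]
    rintro rfl
    exact hmem hs'

variable [Fintype V]

/-- The estimated number of nonempty sets of size at most `t` without an entering or without a
leaving arc. -/
noncomputable def potential (p : ℝ) (t : ℕ) (f : Slot V → Option V) : ℝ :=
  ∑ τ : Bool, ∑ S ∈ Finset.univ.filter (fun S : Finset V => S.Nonempty ∧ S.card ≤ t),
    weight p f τ S

theorem exists_potential_update_le {p : ℝ} (hp : 0 ≤ p) (t : ℕ) {f : Slot V → Option V}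
    {s : Slot V} (hs : f s = none) {A : Finset V} (hA : 1 ≤ p * A.card) :
    ∃ x ∈ A, potential p t (Function.update f s (some x)) ≤ potential p t f := by
  have hne : A.Nonempty := by
    rw [Finset.nonempty_iff_ne_empty]
    rintro rfl
    norm_num at hA
  refine Finset.exists_le_of_sum_le hne ?_
  simp only [potential]
  rw [Finset.sum_comm, Finset.sum_comm (s := A)]
  refine Finset.sum_le_sum fun τ _ => ?_
  rw [Finset.sum_comm, Finset.sum_comm (s := A)]
  exact Finset.sum_le_sum fun S _ => sum_weight_update_le hp hs hA τ S

/-- The filled slots are witnessed by arcs. -/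
def Witnessed (f : Slot V → Option V) (D : Arcs V) : Prop :=
  ∀ v j x, (f (v, true, j) = some x → (x, v) ∈ D) ∧ (f (v, false, j) = some x → (v, x) ∈ D)

/-- A small set with all slots of one direction filled from inside would contribute weight `1` by
itself. -/
theorem smallCutsCrossed_of_potential_lt_one {p : ℝ} (hp : 0 ≤ p) {t : ℕ}
    {f : Slot V → Option V} {D : Arcs V} (hf : Witnessed f D) (hfull : ∀ s, f s ≠ none)
    (hpot : potential p t f < 1) : SmallCutsCrossed t D := by
  have key : ∀ (τ : Bool) (S : Finset V), S.Nonempty → S.card ≤ t →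
      ∃ v ∈ S, ∃ j, ∃ x ∉ S, f (v, τ, j) = some x := by
    intro τ S hS hSt
    by_contra! hcon
    have h1 : weight p f τ S = 1 := by
      refine Finset.prod_eq_one fun s hs => ?_
      obtain ⟨hs1, hs2⟩ := mem_slots.1 hs
      obtain ⟨v, τ', j⟩ := s
      simp only at hs1 hs2
      subst hs2
      obtain ⟨x, hx⟩ := Option.ne_none_iff_exists'.1 (hfull (v, τ', j))
      have hxS : x ∈ S := by
        by_contra hxS
        exact hcon v hs1 j x hxS hx
      simp [hx, slotWeight, hxS]
    have h2 : weight p f τ S ≤ potential p t f := by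
      refine le_trans ?_ (Finset.single_le_sum (f := fun τ => ∑ S ∈ Finset.univ.filter
        (fun S : Finset V => S.Nonempty ∧ S.card ≤ t), weight p f τ S)
        (fun τ _ => Finset.sum_nonneg fun S _ => weight_nonneg hp f τ S) (Finset.mem_univ τ))
      exact Finset.single_le_sum (f := fun S => weight p f τ S)
        (fun S _ => weight_nonneg hp f τ S) (by simp [hS, hSt])
    linarith
  intro S hS hSt
  constructor
  · obtain ⟨v, hv, j, x, hx, hfx⟩ := key false S hS hSt
    exact ⟨v, hv, x, hx, (hf v j x).2 hfx⟩
  · obtain ⟨v, hv, j, x, hx, hfx⟩ := key true S hS hSt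
    exact ⟨x, by simpa using hx, v, by simpa using hv, (hf v j x).1 hfx⟩

/-- The left side is at most `(k ^ k / k!) * (p ^ 2 * n * k) ^ k`, and `k ^ k / k! ≤ e ^ k ≤ 3 ^ k`.
-/
theorem choose_mul_pow_le {p : ℝ} {n t k : ℕ} (hpt : p ^ 2 * n * t ≤ 1 / 24) (hkt : k ≤ t) :
    (n.choose k : ℝ) * (p * k) ^ (2 * k) ≤ (1 / 8) ^ k := by
  have h1 : (n.choose k : ℝ) ≤ (n : ℝ) ^ k / (k.factorial : ℝ) := Nat.choose_le_pow_div k n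
  have h2 : (k : ℝ) ^ k / (k.factorial : ℝ) ≤ 3 ^ k := by
    refine (Real.pow_div_factorial_le_exp (k : ℝ) (Nat.cast_nonneg k) k).trans ?_
    rw [← mul_one (k : ℝ), Real.exp_nat_mul]
    exact pow_le_pow_left₀ (Real.exp_pos _).le (Real.exp_one_lt_d9.le.trans (by norm_num)) _
  have hkt' : (k : ℝ) ≤ t := by exact_mod_cast hkt
  calc (n.choose k : ℝ) * (p * k) ^ (2 * k)
      ≤ (n : ℝ) ^ k / (k.factorial : ℝ) * (p * k) ^ (2 * k) :=
        mul_le_mul_of_nonneg_right h1 (by rw [pow_mul]; positivity)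
    _ = (k : ℝ) ^ k / (k.factorial : ℝ) * (p ^ 2 * n * k) ^ k := by
        rw [pow_mul, mul_pow p, mul_pow, mul_pow, mul_pow, pow_two (k : ℝ), mul_pow]
        ring
    _ ≤ 3 ^ k * (p ^ 2 * n * t) ^ k := by
        refine mul_le_mul h2 (pow_le_pow_left₀ (by positivity) ?_ _) (by positivity) (by positivity)
        exact mul_le_mul_of_nonneg_left hkt' (by positivity)
    _ = (3 * (p ^ 2 * n * t)) ^ k := (mul_pow _ _ _).symm
    _ ≤ (1 / 8) ^ k := pow_le_pow_left₀ (by positivity) (by linarith) _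

/-- For each direction the sizes `k ≥ 1` form a series dominated by `∑ 8 ^ (-k) = 1 / 7`. -/
theorem potential_none_lt_one {p : ℝ} {t : ℕ}
    (hpt : p ^ 2 * Fintype.card V * t ≤ 1 / 24) :
    potential p t (fun _ : Slot V => none) < 1 := by
  have hw : ∀ τ, ∀ S : Finset V,
      weight p (fun _ : Slot V => none) τ S = (p * S.card) ^ (2 * S.card) := by
    intro τ S
    simp [weight, slotWeight, slots, mul_comm]
  have hsum : ∀ τ, ∑ S ∈ Finset.univ.filter (fun S : Finset V => S.Nonempty ∧ S.card ≤ t),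
      weight p (fun _ : Slot V => none) τ S ≤ 1 / 7 := by
    intro τ
    have h1 : ∑ S ∈ Finset.univ.filter (fun S : Finset V => S.Nonempty ∧ S.card ≤ t),
        weight p (fun _ : Slot V => none) τ S = ∑ S ∈ (Finset.univ : Finset V).powerset,
          (fun k : ℕ => if 1 ≤ k ∧ k ≤ t then (p * k) ^ (2 * k) else 0) S.card := by
      rw [Finset.sum_filter, Finset.powerset_univ]
      refine Finset.sum_congr rfl fun S _ => ?_
      simp only [hw, Nat.one_le_iff_ne_zero, ← Nat.pos_iff_ne_zero, Finset.card_pos]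
    rw [h1, Finset.sum_powerset_apply_card
      (fun k : ℕ => if 1 ≤ k ∧ k ≤ t then (p * (k : ℝ)) ^ (2 * k) else 0),
      Finset.sum_range_succ']
    simp only [Finset.card_univ, nsmul_eq_mul]
    have h2 : ∀ k ∈ Finset.range (Fintype.card V), ((Fintype.card V).choose (k + 1) : ℝ) *
        (if 1 ≤ k + 1 ∧ k + 1 ≤ t then (p * ((k + 1 : ℕ) : ℝ)) ^ (2 * (k + 1)) else 0) ≤
          (1 / 8) ^ (k + 1) := by
      intro k _
      split_ifs with hk
      · exact choose_mul_pow_le hpt hk.2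
      · rw [mul_zero]; positivity
    have h3 : ∀ m : ℕ, ∑ k ∈ Finset.range m, (1 / 8 : ℝ) ^ (k + 1) ≤ 1 / 7 - (1 / 7) * (1 / 8) ^ m := by
      intro m
      induction m with
      | zero => simp
      | succ m ih => rw [Finset.sum_range_succ, pow_succ]; linarith
    have h4 : (0 : ℝ) ≤ (1 / 7) * (1 / 8) ^ Fintype.card V := by positivity
    have h5 := Finset.sum_le_sum h2
    have h6 := h3 (Fintype.card V)
    rw [if_neg (by omega : ¬(1 ≤ 0 ∧ 0 ≤ t)), mul_zero, add_zero]
    linarith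
  rw [potential, Fintype.sum_bool]
  linarith [hsum true, hsum false]

end Potential

/-! ### Maker crosses the small cuts -/

section SmallCuts

variable {V : Type*}

/-- The number of filled slots at `v`. -/
def filled (f : Slot V → Option V) (v : V) : ℕ :=
  (Finset.univ.filter fun j : Bool × Bool => f (v, j) ≠ none).card

theorem filled_le_four (f : Slot V → Option V) (v : V) : filled f v ≤ 4 :=
  (Finset.card_filter_le _ _).trans (by simp)

variable [DecidableEq V]

theorem filled_le_filled_update (f : Slot V → Option V) (s : Slot V) (x w : V) :
    filled f w ≤ filled (Function.update f s (some x)) w := by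
  refine Finset.card_le_card fun j hj => ?_
  rw [Finset.mem_filter] at hj ⊢
  refine ⟨Finset.mem_univ _, ?_⟩
  by_cases h : (w, j) = s
  · simp [h]
  · rw [Function.update_of_ne h]; exact hj.2

theorem filled_lt_filled_update {f : Slot V → Option V} {s : Slot V} (hs : f s = none) (x : V) :
    filled f s.1 + 1 ≤ filled (Function.update f s (some x)) s.1 := by
  refine Finset.card_lt_card ((Finset.ssubset_iff_of_subset fun j hj => ?_).2 ⟨s.2, ?_, ?_⟩)
  · rw [Finset.mem_filter] at hj ⊢
    refine ⟨Finset.mem_univ _, ?_⟩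
    by_cases h : (s.1, j) = s
    · simp [h]
    · rw [Function.update_of_ne h]; exact hj.2
  · simp
  · simp [hs]

variable [Fintype V]

/-- The vertices with an empty slot. -/
def active (f : Slot V → Option V) : Finset V :=
  Finset.univ.filter fun v => ∃ j, f (v, j) = none

theorem active_update_subset (f : Slot V → Option V) (s : Slot V) (x : V) :
    active (Function.update f s (some x)) ⊆ active f := by
  intro w hw
  simp only [active, Finset.mem_filter, Finset.mem_univ, true_and] at hw ⊢
  obtain ⟨j, hj⟩ := hw
  refine ⟨j, ?_⟩
  by_cases h : (w, j) = s
  · simp [h] at hj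
  · rwa [Function.update_of_ne h] at hj

/-- Maker can fill all the slots such that all small cuts are crossed, before many edges are
oriented. -/
theorem wins_of_balanced {P : Arcs V → Prop} {b K t M : ℕ} {p : ℝ} (hp : 0 ≤ p) (hK : 1 ≤ K)
    (hfree : 1 ≤ p * (Fintype.card V - 1 -
      (incidentBound (b + 1) (Fintype.card V) K 1 + 8 * (b + 1 : ℕ))))
    (hend : ∀ D : Arcs V, IsOriented D → SmallCutsCrossed t D → D.card ≤ M → Wins 1 b P D)
    (r : ℕ) : ∀ (D : Arcs V) (f : Slot V → Option V), IsOriented D → Witnessed f D →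
      Balanced (b + 1) (Fintype.card V) K D (filled f) (active f) → potential p t f < 1 →
      (Finset.univ.filter fun s => f s = none).card = r → D.card + r * (b + 1) ≤ M →
      Wins 1 b P D := by
  induction r with
  | zero =>
    intro D f hO hf _ hpot hr hM
    refine hend D hO (smallCutsCrossed_of_potential_lt_one hp hf (fun s hs => ?_) hpot) (by omega)
    rw [Finset.card_eq_zero] at hr
    have : s ∈ (∅ : Finset (Slot V)) := hr ▸ Finset.mem_filter.2 ⟨Finset.mem_univ s, hs⟩
    simp at this
  | succ r ih =>
    intro D f hO hf hB hpot hr hM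
    have hact : (active f).Nonempty := by
      obtain ⟨s, hs⟩ := Finset.card_pos.1 (by rw [hr]; exact Nat.succ_pos r)
      exact ⟨s.1, Finset.mem_filter.2 ⟨Finset.mem_univ _, s.2, (Finset.mem_filter.1 hs).2⟩⟩
    obtain ⟨v, hv, hmax⟩ := Finset.exists_max_image (active f)
      (fun v => danger (b + 1) D (filled f) v) hact
    obtain ⟨j, hj⟩ := (Finset.mem_filter.1 hv).2
    -- At most four slots of `v` are filled, whence the term `8 * (b + 1)` in `hfree`.
    have hA : 1 ≤ p * (available D v).card := by
      refine hfree.trans (mul_le_mul_of_nonneg_left ?_ hp)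
      have h1 := hB.degree_le hK hv
      have h2 : (Fintype.card V : ℝ) ≤ (available D v).card + degree D v + 1 := by
        exact_mod_cast card_le_available_add_degree D v
      have h3 : (filled f v : ℝ) ≤ 4 := by exact_mod_cast filled_le_four f v
      have h4 : (0 : ℝ) ≤ (b + 1 : ℕ) := Nat.cast_nonneg _
      nlinarith
    obtain ⟨x, hx, hpot'⟩ := exists_potential_update_le hp t hj hA
    obtain ⟨-, hxv, h1, h2⟩ := Finset.mem_filter.1 hx
    obtain ⟨D', hL, hD'⟩ : ∃ D', LegalMove 1 D D' ∧
        Witnessed (Function.update f (v, j) (some x)) D' := by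
      obtain ⟨τ, i⟩ := j
      cases τ with
      | true =>
        refine ⟨_, legalMove_insert hO hxv h1 h2 le_rfl, fun w i' y => ⟨fun h => ?_, fun h => ?_⟩⟩
        · by_cases hs : (w, true, i') = (v, true, i)
          · rw [hs, Function.update_self, Option.some_inj] at h
            rw [Prod.mk.injEq] at hs
            rw [hs.1, ← h]
            exact Finset.mem_insert_self _ _
          · rw [Function.update_of_ne hs] at h
            exact Finset.mem_insert_of_mem ((hf w i' y).1 h)
        · rw [Function.update_of_ne (by simp)] at h
          exact Finset.mem_insert_of_mem ((hf w i' y).2 h)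
      | false =>
        refine ⟨_, legalMove_insert hO hxv.symm h2 h1 le_rfl,
          fun w i' y => ⟨fun h => ?_, fun h => ?_⟩⟩
        · rw [Function.update_of_ne (by simp)] at h
          exact Finset.mem_insert_of_mem ((hf w i' y).1 h)
        · by_cases hs : (w, false, i') = (v, false, i)
          · rw [hs, Function.update_self, Option.some_inj] at h
            rw [Prod.mk.injEq] at hs
            rw [hs.1, ← h]
            exact Finset.mem_insert_self _ _
          · rw [Function.update_of_ne hs] at h
            exact Finset.mem_insert_of_mem ((hf w i' y).2 h)
    refine .move hL fun D'' hsub hO'' hcard => ?_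
    have hcard' := card_le_of_reply hL.2.2.2 hcard
    refine ih D'' (Function.update f (v, j) (some x)) hO''
      (fun w i y => ⟨fun h => hsub ((hD' w i y).1 h), fun h => hsub ((hD' w i y).2 h)⟩)
      (hB.step hO hv hmax hcard' (active_update_subset _ _ _)
        (filled_le_filled_update f _ x) (filled_lt_filled_update hj x))
      (hpot'.trans_lt hpot) ?_ ?_
    · have : (Finset.univ.filter fun s => Function.update f (v, j) (some x) s = none) =
          (Finset.univ.filter fun s => f s = none).erase (v, j) := by
        ext s
        by_cases hs : s = (v, j)
        · simp [hs]
        · simp [hs]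
      rw [this, Finset.card_erase_of_mem (by simp [hj]), hr]
      rfl
    · have h5 := Finset.card_sdiff_add_card_eq_card (hL.1.trans hsub)
      have h6 : (r + 1) * (b + 1) = r * (b + 1) + (b + 1) := by ring
      omega

theorem wins_empty_of_smallCutsCrossed {P : Arcs V → Prop} {b K t : ℕ} {p : ℝ} (hp : 0 ≤ p)
    (hK : 1 ≤ K) (hfree : 1 ≤ p * (Fintype.card V - 1 -
      (incidentBound (b + 1) (Fintype.card V) K 1 + 8 * (b + 1 : ℕ))))
    (hpt : p ^ 2 * Fintype.card V * t ≤ 1 / 24)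
    (hend : ∀ D : Arcs V, IsOriented D → SmallCutsCrossed t D →
      D.card ≤ 4 * Fintype.card V * (b + 1) → Wins 1 b P D) : Wins 1 b P ∅ := by
  refine wins_of_balanced hp hK hfree hend (4 * Fintype.card V) ∅ (fun _ => none)
    isOriented_empty (fun v j x => by simp) ?_ (potential_none_lt_one hpt) ?_ (by simp)
  · have : filled (fun _ : Slot V => (none : Option V)) = fun _ => 0 := by
      ext v
      simp [filled]
    rw [this]
    exact balanced_empty _ _ _ _
  · simp [Finset.card_univ, mul_comm]

end SmallCuts

/-! ### Estimates and choice of constants -/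

section Asymptotics

theorem two_pow_mul_pow_lt_one {x : ℝ} (hx : 0 ≤ x) {C n : ℕ} (hC : x ^ C < 1 / 2) (hn : n ≠ 0) :
    (2 : ℝ) ^ n * x ^ (C * n) < 1 := by
  rw [pow_mul, ← mul_pow]
  exact pow_lt_one₀ (by positivity) (by linarith) hn

theorem sum_inv_Ico_le_div {K n : ℕ} (hK : 0 < K) :
    ∑ j ∈ Finset.Ico K n, (1 : ℝ) / j ≤ n / K := by
  have hK' : (0 : ℝ) < K := by exact_mod_cast hK
  calc ∑ j ∈ Finset.Ico K n, (1 : ℝ) / j ≤ ∑ j ∈ Finset.Ico K n, (1 : ℝ) / K :=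
        Finset.sum_le_sum fun j hj => one_div_le_one_div_of_le hK'
          (by exact_mod_cast (Finset.mem_Ico.1 hj).1)
    _ = ((n - K : ℕ) : ℝ) * (1 / K) := by rw [Finset.sum_const, Nat.card_Ico, nsmul_eq_mul]
    _ ≤ n * (1 / K) := by gcongr; omega
    _ = n / K := by ring

theorem sum_inv_Ico_one (K : ℕ) :
    ∑ j ∈ Finset.Ico 1 (K + 1), (1 : ℝ) / j = (harmonic K : ℝ) := by
  rw [harmonic_eq_sum_Icc, Finset.Ico_add_one_right_eq_Icc]
  push_cast
  simp

/-- Only the range from `K` to `n` carries the factor `2`, and it costs `2 * q * (n / K)`, which is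
`O(q)` for `K` proportional to `n`. The range below `K` gives the leading term `q * log n`. -/
theorem incidentBound_one_le {q n K : ℕ} (hK : 0 < K) (hKn : K ≤ n) :
    incidentBound q n K 1 ≤ 2 * q * (n / K) + (K - 1) + q * (1 + Real.log n) := by
  obtain ⟨k, rfl⟩ : ∃ k, K = k + 1 := ⟨K - 1, by omega⟩
  have hq : (0 : ℝ) ≤ q := Nat.cast_nonneg q
  have h1 := sum_inv_Ico_le_div (n := n) hK
  have h2 : (harmonic k : ℝ) ≤ 1 + Real.log n := by
    refine (harmonic_le_one_add_log k).trans ?_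
    rcases Nat.eq_zero_or_pos k with rfl | hk
    · simpa using Real.log_natCast_nonneg n
    · gcongr
      omega
  have h3 : ∑ j ∈ Finset.Ico 1 (k + 1), (1 + (q : ℝ) / j) = k + q * (harmonic k : ℝ) := by
    rw [Finset.sum_add_distrib, ← sum_inv_Ico_one, Finset.mul_sum]
    simp [div_eq_mul_inv]
  rw [incidentBound, dangerBound, h3]
  push_cast at h1 ⊢
  have h4 := mul_le_mul_of_nonneg_left h1 (by positivity : (0 : ℝ) ≤ 2 * q)
  have h5 := mul_le_mul_of_nonneg_left h2 hq
  linarith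

theorem le_boxBound {b m : ℕ} (hm : 2 ≤ m) (hmb : m ≤ b) :
    (b : ℝ) * Real.log m - 2 * m ≤ (boxBound b m (m - 1) : ℕ) := by
  obtain ⟨k, rfl⟩ : ∃ k, m = k + 2 := ⟨m - 2, by omega⟩
  have hb : (0 : ℝ) ≤ b := Nat.cast_nonneg b
  have h1 : Real.log ((k + 2 : ℕ) : ℝ) ≤ (harmonic (k + 1) : ℝ) :=
    log_add_one_le_harmonic (k + 1)
  have h2 : ∑ j ∈ Finset.Ico 2 (k + 2), ((b : ℝ) * (1 / j) - 1) ≤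
      ∑ j ∈ Finset.Ico 2 (k + 2), ((b / j : ℕ) : ℝ) := by
    refine Finset.sum_le_sum fun j hj => ?_
    have hj' : 0 < j := by have := (Finset.mem_Ico.1 hj).1; omega
    have hj'' : (0 : ℝ) < j := by exact_mod_cast hj'
    have h3 : b < j * (b / j + 1) := Nat.lt_mul_div_succ b hj'
    have h4 : (b : ℝ) < j * ((b / j : ℕ) + 1) := by exact_mod_cast h3
    rw [mul_one_div, sub_le_iff_le_add, div_le_iff₀ hj'']
    linarith
  rw [Finset.sum_sub_distrib, ← Finset.mul_sum, Finset.sum_const, Nat.card_Ico, nsmul_eq_mul,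
    mul_one] at h2
  have h3 := sum_inv_Ico_one (k + 1)
  rw [Finset.sum_eq_sum_Ico_succ_bot (by omega)] at h3
  rw [← h3] at h1
  have h5 : ((b - (k + 2) : ℕ) : ℝ) = b - (k + 2 : ℕ) := Nat.cast_sub hmb
  have h6 := mul_le_mul_of_nonneg_left h1 hb
  rw [boxBound]
  push_cast [h5] at h2 h6 ⊢
  norm_num at h2 h6 ⊢
  linarith

theorem tendsto_log_natCast : Tendsto (fun n : ℕ => Real.log n) atTop atTop :=
  Real.tendsto_log_atTop.comp tendsto_natCast_atTop_atTop

theorem eventually_log_le_mul {γ : ℝ} (hγ : 0 < γ) : ∀ᶠ x : ℝ in atTop, Real.log x ≤ γ * x := by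
  filter_upwards [Real.isLittleO_log_id_atTop.bound hγ, eventually_ge_atTop 1] with x hx hx1
  simp only [id, Real.norm_eq_abs] at hx
  rw [abs_of_nonneg (by linarith : (0 : ℝ) ≤ x)] at hx
  exact (le_abs_self _).trans hx

theorem eventually_breakerCanForce {ε : ℝ} (hε : 0 < ε) : ∀ᶠ n : ℕ in atTop, ∀ b : ℕ,
    (1 + ε) * (n : ℝ) / Real.log (n : ℝ) ≤ (b : ℝ) → BreakerCanForce (Fin n) 1 b HasSource := by
  -- This choice makes `(1 + ε) * (1 - γ) = 1 + γ`: replacing `log n` by `log m` costs a factor `1 -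
  -- γ`, and the surplus `γ * n` still pays for `m`.
  set γ := ε / (2 + ε) with hγ
  have hγ0 : 0 < γ := by positivity
  have hlog2 : ∀ᶠ n : ℕ in atTop, Real.log (2 * Real.log n) ≤ γ / 2 * (2 * Real.log n) :=
    (tendsto_log_natCast.const_mul_atTop (by norm_num : (0 : ℝ) < 2)).eventually
      (eventually_log_le_mul (by positivity : 0 < γ / 2))
  have hlog : ∀ᶠ n : ℕ in atTop, Real.log n ≤ 1 / 3 * n :=
    tendsto_natCast_atTop_atTop.eventually (eventually_log_le_mul (by norm_num : (0 : ℝ) < 1 / 3))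
  filter_upwards [hlog2, hlog, tendsto_log_natCast.eventually_ge_atTop (1 / γ),
    tendsto_log_natCast.eventually_ge_atTop 1, eventually_ge_atTop 1] with n h1 h2 h3 h4 hn b hb
  have hn0 : (0 : ℝ) < n := by exact_mod_cast hn
  have hl0 : 0 < Real.log n := by linarith
  set x := (n : ℝ) / Real.log n with hx
  have hxn : x * Real.log n = n := div_mul_cancel₀ _ hl0.ne'
  have hx3 : 3 ≤ x := by rw [hx, le_div_iff₀ hl0]; linarith
  have hxγ : x ≤ γ * n := by
    rw [hx, div_le_iff₀ hl0]
    have : 1 ≤ γ * Real.log n := by rwa [div_le_iff₀' hγ0] at h3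
    nlinarith
  have hxle : x ≤ n := by nlinarith
  set m := ⌊x⌋₊ with hm
  have hm1 : (m : ℝ) ≤ x := Nat.floor_le (by linarith)
  have hm2 : x < m + 1 := Nat.lt_floor_add_one x
  have hm3 : 2 ≤ m := Nat.le_floor (by push_cast; linarith)
  have hbx : (1 + ε) * x ≤ b := by rw [hx, ← mul_div_assoc]; exact hb
  have hmb : m ≤ b := by
    have : (m : ℝ) ≤ b := by nlinarith
    exact_mod_cast this
  have hmn : m ≤ n := by
    have : (m : ℝ) ≤ n := by linarith
    exact_mod_cast this
  have hlogm : (1 - γ) * Real.log n ≤ Real.log m := by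
    have h5 : Real.log (n / (2 * Real.log n)) ≤ Real.log m := by
      refine Real.log_le_log (by positivity) ?_
      have : (n : ℝ) / (2 * Real.log n) = x / 2 := by rw [hx]; field_simp
      rw [this]
      linarith
    rw [Real.log_div hn0.ne' (by positivity)] at h5
    linarith
  refine breakerCanForce_hasSource hm3 hmb (by simpa using hmn) ?_
  rw [Fintype.card_fin, tsub_le_iff_right]
  have hbox := le_boxBound hm3 hmb
  have hγ1 : (1 + ε) * (1 - γ) = 1 + γ := by
    rw [hγ]
    field_simp
    ring
  have hγlt : 0 ≤ 1 - γ := by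
    rw [hγ, sub_nonneg, div_le_one (by positivity)]
    linarith
  have hfin : (1 + γ) * n ≤ b * Real.log m := by
    calc (1 + γ) * n = (1 + ε) * (1 - γ) * (x * Real.log n) := by rw [hγ1, hxn]
      _ = ((1 + ε) * x) * ((1 - γ) * Real.log n) := by ring
      _ ≤ b * Real.log m := mul_le_mul hbx hlogm (by positivity) (Nat.cast_nonneg b)
  have : (n : ℝ) ≤ (boxBound b m (m - 1) : ℕ) + (m : ℕ) := by linarith
  exact_mod_cast this

/-- A version of the second part with explicit requirements on the size. -/
theorem makerCanForce_of_bounds {V : Type*} [Fintype V] [DecidableEq V] {b n C : ℕ}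
    {ε γ κ : ℝ} (hV : Fintype.card V = n) (hn : 1 < n) (hε : 0 < ε) (hε1 : ε < 1)
    (hκ : κ = ε ^ 2 / 384) (hC : (1 - κ / 8) ^ C < 1 / 2)
    (hγ1 : γ * (8 / ε + 11) ≤ ε / 2) (hγ2 : (4 + C) * γ ≤ κ / 8) (hone : 1 ≤ γ * n)
    (hn2 : 8 ≤ κ * n ^ 2)
    (hlog : Real.log n ≤ γ * n) (hq : ((b + 1 : ℕ) : ℝ) ≤ γ * n)
    (hql : (b : ℝ) * Real.log n ≤ (1 - ε) * n) :
    MakerCanForce V 1 b HasHamiltonCycle := by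
  have hn0 : (0 : ℝ) < n := by positivity
  have hκ0 : 0 < κ := by rw [hκ]; positivity
  have hκ1 : κ ≤ 1 := by rw [hκ]; nlinarith
  set q : ℝ := ((b + 1 : ℕ) : ℝ) with hqdef
  have hq0 : 0 ≤ q := Nat.cast_nonneg _
  have hqb : q = b + 1 := by rw [hqdef]; push_cast; ring
  -- Of the slack `ε * n` in the degree bound, `K - 1` uses at most a quarter, the error terms at
  -- most half, and the last quarter stays available.
  set K := ⌈ε / 4 * n⌉₊ with hKdef
  have hK1 : 0 < K := Nat.ceil_pos.2 (by positivity)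
  have hK2 : ε / 4 * n ≤ K := Nat.le_ceil _
  have hK3 : (K : ℝ) < ε / 4 * n + 1 := Nat.ceil_lt_add_one (by positivity)
  have hKn : K ≤ n := Nat.ceil_le.2 (by nlinarith)
  set t := ⌊κ * n⌋₊ with htdef
  have ht : (t : ℝ) ≤ κ * n := Nat.floor_le (by positivity)
  -- If both sides of a cut exceed `κ * n`, the larger has at least `n / 2` vertices, so the product
  -- of the sizes is at least `2 * E`.
  set E := ⌊κ * n ^ 2 / 4⌋₊ with hEdef
  have hE1 : (E : ℝ) ≤ κ * n ^ 2 / 4 := Nat.floor_le (by positivity)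
  have hE2 : κ * n ^ 2 / 4 < E + 1 := Nat.lt_floor_add_one _
  -- `p` is the reciprocal of the guaranteed number `ε * n / 4` of choices; `κ = ε ^ 2 / 384` then
  -- makes `p ^ 2 * n * (κ * n) = 1 / 24`.
  set p := 4 / (ε * n) with hpdef
  have hp : 0 ≤ p := by positivity
  have hmid : ∀ S : Finset V, t < S.card → t < Sᶜ.card → 2 * E ≤ S.card * Sᶜ.card := by
    intro S h1 h2
    have h1' : κ * n < S.card := Nat.lt_of_floor_lt h1
    have h2' : κ * n < Sᶜ.card := Nat.lt_of_floor_lt h2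
    have h3 : (S.card : ℝ) + Sᶜ.card = n := by
      rw [← hV]
      exact_mod_cast Finset.card_add_card_compl S
    have h4 : (2 : ℝ) * E ≤ S.card * Sᶜ.card := by
      have hκn : 0 < κ * n := by positivity
      rcases le_total (S.card : ℝ) Sᶜ.card with h | h
      · have : (n : ℝ) / 2 ≤ Sᶜ.card := by linarith
        have := mul_le_mul h1'.le this (by positivity) (by linarith)
        nlinarith
      · have : (n : ℝ) / 2 ≤ S.card := by linarith
        have := mul_le_mul this h2'.le (by positivity) (by linarith)
        nlinarith
    exact_mod_cast h4
  refine makerCanForce_of_wins le_rfl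
    (wins_empty_of_smallCutsCrossed (K := K) (t := t) (p := p) hp hK1 ?_ ?_ ?_)
  · have h1 := incidentBound_one_le (q := b + 1) hK1 hKn
    have h2 : (n : ℝ) / K ≤ 4 / ε := by
      rw [div_le_div_iff₀ (by exact_mod_cast hK1) hε]
      linarith
    have h3 : q * Real.log n ≤ (1 - ε) * n + γ * n := by rw [hqb]; linarith
    have h4 := mul_le_mul_of_nonneg_left h2 (by positivity : (0 : ℝ) ≤ 2 * q)
    have h5 : q * (8 / ε + 9) ≤ γ * n * (8 / ε + 9) :=
      mul_le_mul_of_nonneg_right hq (by positivity)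
    -- Beyond the `8 / ε + 9` multiples of `q`, one more `γ * n` covers `log n` from `q = b + 1`,
    -- and another is to spare.
    have h6 : γ * n * (8 / ε + 11) ≤ ε / 2 * n := by nlinarith
    rw [← hqdef] at h1
    rw [hV, ← hqdef]
    have h7 : ε / 4 * n ≤ n - 1 - (incidentBound (b + 1) n K 1 + 8 * q) := by
      have h8 : 2 * q * (4 / ε) = q * (8 / ε) := by ring
      linarith
    calc (1 : ℝ) = p * (ε / 4 * n) := by rw [hpdef]; field_simp
      _ ≤ _ := mul_le_mul_of_nonneg_left h7 hp
  · rw [hV]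
    calc p ^ 2 * n * t ≤ p ^ 2 * n * (κ * n) := mul_le_mul_of_nonneg_left ht (by positivity)
      _ = 1 / 24 := by rw [hpdef, hκ]; field_simp; norm_num
  · intro D hO hs hD
    -- `θ = κ / 8` rather than `κ / 4` absorbs the rounding in `E`, since `8 ≤ κ * n ^ 2`.
    refine wins_of_smallCutsCrossed (t := t) (E := E) (θ := κ / 8) (by omega) (by positivity)
      (by linarith) (by rw [hV]; linarith) hmid (C * n) D hO hs ?_ ?_
    · have h1 : (4 + C) * (n * q) ≤ κ / 8 * n ^ 2 := by
        calc (4 + C) * (n * q) ≤ (4 + C) * (n * (γ * n)) := by gcongr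
          _ = (4 + C) * γ * n ^ 2 := by ring
          _ ≤ _ := by gcongr
      have h2 : ((4 * n * (b + 1) + C * n * (b + 1) : ℕ) : ℝ) ≤ E := by
        have : ((4 * n * (b + 1) + C * n * (b + 1) : ℕ) : ℝ) = (4 + C) * (n * q) := by
          rw [hqb]; push_cast; ring
        rw [this]
        linarith
      rw [hV] at hD
      exact (Nat.add_le_add_right hD _).trans (by exact_mod_cast h2)
    · refine lt_of_le_of_lt (mul_le_mul_of_nonneg_right ?_ (pow_nonneg (by linarith) _))
        (two_pow_mul_pow_lt_one (by linarith) hC (by omega : n ≠ 0))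
      have h1 := Finset.card_le_univ (uncrossed t D)
      rw [Fintype.card_finset, hV] at h1
      exact_mod_cast h1

theorem eventually_makerCanForce {ε : ℝ} (hε : 0 < ε) : ∀ᶠ n : ℕ in atTop, ∀ b : ℕ, 1 ≤ b →
    (b : ℝ) ≤ (1 - ε) * (n : ℝ) / Real.log (n : ℝ) →
      MakerCanForce (Fin n) 1 b HasHamiltonCycle := by
  rcases le_or_gt 1 ε with hε1 | hε1
  · filter_upwards with n b hb hbn
    have h1 : (1 : ℝ) ≤ b := by exact_mod_cast hb
    have h2 : (1 - ε) * (n : ℝ) / Real.log (n : ℝ) ≤ 0 :=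
      div_nonpos_of_nonpos_of_nonneg (mul_nonpos_of_nonpos_of_nonneg (by linarith)
        (Nat.cast_nonneg n)) (Real.log_natCast_nonneg n)
    linarith
  set κ := ε ^ 2 / 384 with hκ
  have hκ0 : 0 < κ := by positivity
  obtain ⟨C, hC⟩ := exists_pow_lt_of_lt_one (by norm_num : (0 : ℝ) < 1 / 2)
    (by linarith : 1 - κ / 8 < 1)
  obtain ⟨γ, hγ0, hγ1, hγ2⟩ : ∃ γ : ℝ, 0 < γ ∧ γ * (8 / ε + 11) ≤ ε / 2 ∧
      (4 + C) * γ ≤ κ / 8 := by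
    refine ⟨min (ε / 2 / (8 / ε + 11)) (κ / 8 / (4 + C)), by positivity, ?_, ?_⟩
    · rw [← le_div_iff₀ (by positivity)]
      exact min_le_left _ _
    · rw [← le_div_iff₀' (by positivity)]
      exact min_le_right _ _
  have hlog : ∀ᶠ n : ℕ in atTop, Real.log n ≤ γ * n :=
    tendsto_natCast_atTop_atTop.eventually (eventually_log_le_mul hγ0)
  filter_upwards [hlog, tendsto_log_natCast.eventually_ge_atTop (2 / γ),
    tendsto_natCast_atTop_atTop.eventually_ge_atTop (2 / γ),
    tendsto_natCast_atTop_atTop.eventually_ge_atTop (8 / κ),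
    eventually_gt_atTop 1] with n h1 h2 h3 h4 hn b _ hbn
  have hn0 : (1 : ℝ) < n := by exact_mod_cast hn
  have hl0 : 0 < Real.log n := Real.log_pos hn0
  rw [div_le_iff₀' hγ0] at h2 h3
  rw [div_le_iff₀' hκ0] at h4
  have hql : (b : ℝ) * Real.log n ≤ (1 - ε) * n := by rwa [le_div_iff₀ hl0] at hbn
  have hb : (b : ℝ) ≤ γ / 2 * n := by
    have h5 : (b : ℝ) * Real.log n ≤ γ / 2 * n * Real.log n := by nlinarith
    exact le_of_mul_le_mul_right h5 hl0
  refine makerCanForce_of_bounds (Fintype.card_fin n) hn hε hε1 hκ hC hγ1 hγ2 (by linarith)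
    (by nlinarith) h1 ?_ hql
  push_cast
  linarith

end Asymptotics

end OrientationGame

theorem theorem2 :
    (∀ ε : ℝ, 0 < ε → ∀ᶠ n : ℕ in atTop, ∀ b : ℕ,
      (1 + ε) * (n : ℝ) / Real.log (n : ℝ) ≤ (b : ℝ) →
        OrientationGame.BreakerCanForce (Fin n) 1 b (fun T =>
          (∃ v : Fin n, OrientationGame.inDegree T v = 0) ∧
            ¬ OrientationGame.HasHamiltonCycle T)) ∧
    (∀ ε : ℝ, 0 < ε → ∀ᶠ n : ℕ in atTop, ∀ b : ℕ, 1 ≤ b →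
      (b : ℝ) ≤ (1 - ε) * (n : ℝ) / Real.log (n : ℝ) →
        OrientationGame.MakerCanForce (Fin n) 1 b (fun T =>
          OrientationGame.HasHamiltonCycle T)) :=
  ⟨fun _ hε => OrientationGame.eventually_breakerCanForce hε,
    fun _ hε => OrientationGame.eventually_makerCanForce hε⟩
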